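/- **Conventions.** Let $R$ be a commutative unital ring and $G$ a finite simple connected graph with totally ordered vertex set $V$ (edges are understood to be bidirected). A cut-vertex is one whose removal disconnects the graph. The strong blocks $\{G_e : e\in E\}$ are the maximal connected subgraphs without cut-vertices; write $v \in e$ for $v\in V(G_e)$ and $p_e = |V(G_e)|$. Assume $G$ is a *hypertree*: every $G_e$ is a clique. Let ${\bf e}$ be the all-ones vector and $J={\bf e}{\bf e}^T$. For each block let $a_e, m_{e,v}, m'_{e,v}\in R$ ($v\in e$), and let $D^*_{G_e}$ have diagonal entries $1$ and entries $(D^*_{G_e})_{vw}=m_{e,v}m'_{e,w}$ for $v\ne w$; put $D_{\mathcal G_e}=a_e(D^*_{G_e}-J)$. The matrices $D^*_G=(m_{ij})$ and $D_{\mathcal G}=(d_{ij})$ have principal submatrices $D^*_{G_e}$, respectively $D_{\mathcal G_e}$, on the blocks; and if $i,j$ lie in no common block and $v\neq i,j$ lies on every path from $i$ to $j$, then inductively $m_{ij}=m_{iv}m_{vj}$ and $d_{ij}=d_{iv}+m_{iv}d_{vj}$. For a vertex $v_0$ let $\kappa(D_{\mathcal G},v_0)=\det\big(d_{xy}-d_{xv_0}-m_{xv_0}d_{v_0y}\big)_{x,y\ne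 v_0}$, and likewise for each block with $(D_{\mathcal G_e}, D^*_{G_e})$; these values do not depend on $v_0$ and are written $\kappa(D_{\mathcal G})$, $\kappa(D_{\mathcal G_e})$. Assume that $D^*_G$ and all $a_e$ are invertible; then so are $\kappa(D_{\mathcal G})$ and all $\kappa(D_{\mathcal G_e})$. Put $$\alpha_{\mathcal G}=\frac{\det D_{\mathcal G}}{\kappa(D_{\mathcal G})},\qquad \tau_{\rm in}^T={\bf e}^T(D^*_G)^{-1},\qquad \tau_{\rm out}=(D^*_G)^{-1}{\bf e},$$ and let the Laplacian $L_{\mathcal G}=(l_{ij})$ have $l_{ij}=-\frac1{a_e}((D_G^*)^{-1})_{ij}$ if $i\ne j$ lie in a block $e$, $l_{ij}=0$ if $i,j$ lie in different blocks, and $l_{jj}=-\sum_{k\ne j}l_{kj}$. For $i\in e$ let $G_{i\to e}$ be the maximum connected induced subgraph containing $G_e$ of which $i$ is not a cut-vertex. If $D_{\mathcal G}$ is invertible, put $$\beta_i=\frac{\kappa(D_{\mathcal G})}{\det D_{\mathcal G}}\sum_{e\ni i}\frac1{a_e}\sum_{f\subset G_{i\to e}}\frac{\det D_{\mathcal G_f}}{\kappa(D_{\mathcal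 G_f})},$$ and let $C_{\mathcal G}$ have $(C_{\mathcal G})_{ii}=\beta_i$ and $(C_{\mathcal G})_{ij}=\beta_i-\frac1{a_e}$ if $j\neq i$, where $e$ is the block containing $i$ with $j\in G_{i\to e}$. **Fractions.** Put $\delta_{e,v}=1-m_{e,v}m'_{e,v}$, $s_e=\sum_{v\in e}\frac{m_{e,v}m'_{e,v}}{\delta_{e,v}}$, and $N_e=\prod_{v\in e}\delta_{e,v}+\sum_{v\in e}m_{e,v}m'_{e,v}\prod_{u\in e,u\ne v}\delta_{e,u}$, which is "$(1+s_e)\prod_{v \in e}\delta_{e,v}$" with denominators cancelled. The $\delta_{e,v}$ in denominators are placeholders: $\frac1{1+s_e}$ and $\frac1{(1+s_e)\delta_{e,v}\delta_{e,w}}$ ($v\ne w$ in $e$) stand for $$N_e^{-1}\prod_{u\in e}\delta_{e,u}\qquad\text{and}\qquad N_e^{-1}\prod_{u\in e,\,u\ne v,w}\delta_{e,u}.$$ **Statement.** Every $N_e$ is invertible; and if all $\delta_{e,v}$ ($v\in e$) are invertible, then so is $1+s_e$ and the two fractions have their literal meaning. Set $$\alpha_e:=\frac{-a_e}{1+s_e}\Big(p_e-1+\sum_{v<w\in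 e}\frac{(m_{e,v}-m_{e,w})(m'_{e,v}-m'_{e,w})}{\delta_{e,v}\delta_{e,w}}\Big).$$ Then $$\alpha_{\mathcal G}=\sum_{e\in E}\alpha_e,$$ $$(\tau_{\rm in})_v=1-\sum_{e\ni v}\frac1{1+s_e}\sum_{w\in e,w\ne v}\frac{m_{e,w}m'_{e,v}(1-m_{e,v}m'_{e,w})}{\delta_{e,v}\delta_{e,w}},$$ $$(\tau_{\rm out})_v=1-\sum_{e\ni v}\frac1{1+s_e}\sum_{w\in e,w\ne v}\frac{m'_{e,w}m_{e,v}(1-m'_{e,v}m_{e,w})}{\delta_{e,v}\delta_{e,w}},$$ $$(L_{\mathcal G})_{vw}=\begin{cases}0,& v\ne w,\ v\not\sim w,\\[1mm] \dfrac{m_{e,v}m'_{e,w}}{a_e(1+s_e)\delta_{e,v}\delta_{e,w}},& v\sim w\in e,\\[2mm] \displaystyle\sum_{e\ni w}\frac{-1}{a_e(1+s_e)}\sum_{u\in e,u\ne w}\frac{m_{e,u}m'_{e,w}}{\delta_{e,u}\delta_{e,w}},& v=w.\end{cases}$$ If moreover $D_{\mathcal G}$ is invertible, then $\alpha_{\mathcal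 G}$ is invertible, $$\beta_i=\frac1{\alpha_{\mathcal G}}\sum_{e\ni i}\frac1{a_e}\sum_{f\subset G_{i\to e}}\alpha_f,$$ and $$D_{\mathcal G}^{-1}=\frac1{\alpha_{\mathcal G}}\tau_{\rm out}\tau_{\rm in}^T+C_{\mathcal G}(D_G^*)^{-1}=\frac1{\alpha_{\mathcal G}}\tau_{\rm out}\tau_{\rm in}^T-L_{\mathcal G}+C_{\mathcal G}\,{\rm diag}(\tau_{\rm in}).$$ -/

import Mathlib

open Matrix
open scoped Classical

namespace AddMulGraph

variable {V : Type*} {R : Type*} {ι : Type*}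

/-! ### Strong blocks, hypertrees -/

/-- The subgraph of `G` induced on `S` is connected, and removing the vertex `v` from it does not
disconnect it (if `v ∈ S`, then `v` is not a cut-vertex of this subgraph). -/
def ConnWithoutCut (G : SimpleGraph V) (S : Set V) (v : V) : Prop :=
  (G.induce S).Connected ∧ (G.induce (S \ {v})).Preconnected

/-- `B` is the vertex set of a strong block of `G`: a maximal connected subgraph without
cut-vertices. (A maximal such subgraph is automatically an induced one.) -/
def IsBlock (G : SimpleGraph V) (B : Set V) : Prop :=
  Maximal (fun S : Set V => (G.induce S).Connected ∧ ∀ v ∈ S, ConnWithoutCut G S v) B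

/-- The index set `E` of the strong blocks of `G`. -/
@[ext]
structure Block (G : SimpleGraph V) where
  verts : Finset V
  isBlock : IsBlock G (verts : Set V)

instance finiteBlock [Finite V] (G : SimpleGraph V) : Finite (Block G) :=
  Finite.of_injective (fun e : Block G => e.verts) (fun _ _ h => Block.ext h)

noncomputable instance fintypeBlock [Finite V] (G : SimpleGraph V) : Fintype (Block G) :=
  Fintype.ofFinite _

/-- A hypertree: a connected graph all of whose strong blocks are cliques. -/
def IsHypertree (G : SimpleGraph V) : Prop :=
  G.Connected ∧ ∀ e : Block G, G.IsClique (e.verts : Set V)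

/-- `v` is a vertex different from `i` and `j` which lies on every path from `i` to `j`. -/
def Separates (G : SimpleGraph V) (v i j : V) : Prop :=
  v ≠ i ∧ v ≠ j ∧ G.Reachable i j ∧ ∀ p : G.Walk i j, v ∈ p.support

theorem Separates.dist_add {G : SimpleGraph V} {v i j : V} (h : Separates G v i j) :
    G.dist i v < G.dist i j ∧ G.dist v j < G.dist i j := by
  obtain ⟨hi, hj, hr, hp⟩ := h
  obtain ⟨p, hlen⟩ := hr.exists_walk_length_eq_dist
  have hv := hp p
  have hsum : (p.takeUntil v hv).length + (p.dropUntil v hv).length = p.length := by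
    rw [← SimpleGraph.Walk.length_append, p.take_spec hv]
  have h1 := SimpleGraph.dist_le (p.takeUntil v hv)
  have h2 := SimpleGraph.dist_le (p.dropUntil v hv)
  have h3 : 0 < G.dist i v :=
    (p.takeUntil v hv).reachable.pos_dist_of_ne (Ne.symm hi)
  have h4 : 0 < G.dist v j := (p.dropUntil v hv).reachable.pos_dist_of_ne hj
  omega

/-- The vertex set of `G_{i → e}`: the maximum connected induced subgraph of `G` that contains the
block `e` and for which `i` is not a cut-vertex. -/
def branch (G : SimpleGraph V) (i : V) (e : Block G) : Set V :=
  ⋃₀ {S : Set V | (e.verts : Set V) ⊆ S ∧ ConnWithoutCut G S i}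

/-! ### Block-data and their distance matrices -/

/-- An additive-multiplicative block-datum `{(a_e, D*_{G_e})}` attached to `G`. -/
structure BlockDatum (G : SimpleGraph V) (R : Type*) [CommRing R] where
  a : Block G → R
  Dstar : (e : Block G) → Matrix e.verts e.verts R
  diag : ∀ e v, Dstar e v v = 1

namespace BlockDatum

variable {G : SimpleGraph V} [CommRing R]

/-- The entries `m_{ij}` of the multiplicative distance matrix: prescribed inside each block, and
`m_{ij} = m_{iv} m_{vj}` if `i, j` share no block and `v` is a cut-vertex separating them. -/
noncomputable def multDist (𝒢 : BlockDatum G R) (i j : V) : R :=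
  if h : ∃ e : Block G, i ∈ e.verts ∧ j ∈ e.verts then
    𝒢.Dstar h.choose ⟨i, h.choose_spec.1⟩ ⟨j, h.choose_spec.2⟩
  else if h : ∃ v, Separates G v i j then
    multDist 𝒢 i h.choose * multDist 𝒢 h.choose j
  else 0
termination_by G.dist i j
decreasing_by
  · exact h.choose_spec.dist_add.1
  · exact h.choose_spec.dist_add.2

/-- The entries `d_{ij}` of the additive-multiplicative distance matrix: `a_e (m_{ij} - 1)` inside
each block `e`, and `d_{ij} = d_{iv} + m_{iv} d_{vj}` if `i, j` share no block and `v` is a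
cut-vertex separating them. -/
noncomputable def addMultDist (𝒢 : BlockDatum G R) (i j : V) : R :=
  if h : ∃ e : Block G, i ∈ e.verts ∧ j ∈ e.verts then
    𝒢.a h.choose * (𝒢.Dstar h.choose ⟨i, h.choose_spec.1⟩ ⟨j, h.choose_spec.2⟩ - 1)
  else if h : ∃ v, Separates G v i j then
    addMultDist 𝒢 i h.choose + 𝒢.multDist i h.choose * addMultDist 𝒢 h.choose j
  else 0
termination_by G.dist i j
decreasing_by
  · exact h.choose_spec.dist_add.1
  · exact h.choose_spec.dist_add.2

/-- The multiplicative distance matrix `D*_G`. -/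
noncomputable def multMat (𝒢 : BlockDatum G R) : Matrix V V R :=
  Matrix.of 𝒢.multDist

/-- The additive-multiplicative distance matrix `D_𝒢`. -/
noncomputable def distMat (𝒢 : BlockDatum G R) : Matrix V V R :=
  Matrix.of 𝒢.addMultDist

/-- The matrix `D_{𝒢_e} = a_e (D*_{G_e} - J)` of a block. -/
def blockMat (𝒢 : BlockDatum G R) (e : Block G) : Matrix e.verts e.verts R :=
  Matrix.of fun v w => 𝒢.a e * (𝒢.Dstar e v w - 1)

end BlockDatum

/-- The invariant `κ(D, v₀)` of a distance matrix `D` with multiplicative distance matrix `M`: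
the determinant of `D|_{V ∖ v₀} - u e^T - m w^T`, where `u`, `m` are the columns of `v₀` in `D`
and `M`, and `w^T` is the row of `v₀` in `D`. -/
noncomputable def kappaAt [Fintype ι] [DecidableEq ι] [CommRing R] (D M : Matrix ι ι R)
    (v₀ : ι) : R :=
  Matrix.det (Matrix.of fun x y : {x : ι // x ≠ v₀} => D x y - D x v₀ - M x v₀ * D v₀ y)

/-- The common value `κ(D)` of the `κ(D, v₀)`, taken at some vertex `v₀`. -/
noncomputable def kappa [Fintype ι] [DecidableEq ι] [CommRing R] (D M : Matrix ι ι R) : R :=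
  if h : Nonempty ι then kappaAt D M h.some else 1

/-! ### The ingredients of the inverse: `τ_in`, `τ_out`, `α`, `β`, `C`, `L` -/

namespace BlockDatum

variable [Fintype V] [DecidableEq V] {G : SimpleGraph V} [CommRing R]

/-- `τ_in^T = e^T (D*_G)⁻¹`. -/
noncomputable def tauIn (𝒢 : BlockDatum G R) : V → R :=
  (fun _ => 1) ᵥ* 𝒢.multMat⁻¹

/-- `τ_out = (D*_G)⁻¹ e`. -/
noncomputable def tauOut (𝒢 : BlockDatum G R) : V → R :=
  𝒢.multMat⁻¹ *ᵥ (fun _ => 1)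

/-- `κ(D_𝒢)`. -/
noncomputable def kap (𝒢 : BlockDatum G R) : R :=
  kappa 𝒢.distMat 𝒢.multMat

/-- `κ(D_{𝒢_e})`. -/
noncomputable def blockKap (𝒢 : BlockDatum G R) (e : Block G) : R :=
  kappa (𝒢.blockMat e) (𝒢.Dstar e)

/-- `α_𝒢 = det(D_𝒢) / κ(D_𝒢)`. -/
noncomputable def alpha (𝒢 : BlockDatum G R) : R :=
  𝒢.distMat.det * Ring.inverse 𝒢.kap

/-- `β_i = (κ(D_𝒢) / det(D_𝒢)) ∑_{e ∋ i} (1 / a_e) ∑_{f ⊆ G_{i → e}} det(D_{𝒢_f}) / κ(D_{𝒢_f})`. -/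
noncomputable def beta (𝒢 : BlockDatum G R) (i : V) : R :=
  𝒢.kap * Ring.inverse 𝒢.distMat.det *
    ∑ e : Block G with i ∈ e.verts, Ring.inverse (𝒢.a e) *
      ∑ f : Block G with (f.verts : Set V) ⊆ branch G i e,
        (𝒢.blockMat f).det * Ring.inverse (𝒢.blockKap f)

/-- The matrix `C_𝒢`: its `(i, i)` entry is `β_i`, and its `(i, j)` entry for `j ≠ i` is
`β_i - 1 / a_e`, where `e` is the unique block containing `i` with `j ∈ G_{i → e}`
(so the sum below has a single term). -/
noncomputable def cMat (𝒢 : BlockDatum G R) : Matrix V V R :=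
  Matrix.of fun i j =>
    if i = j then 𝒢.beta i
    else 𝒢.beta i -
      ∑ e : Block G with i ∈ e.verts ∧ j ∈ branch G i e, Ring.inverse (𝒢.a e)

/-- Off-diagonal entries of the Laplacian: `-(1 / a_e) ((D*_G)⁻¹)_{ij}` if `i ≠ j` lie in a block
`e` (which is then unique, so the sum below has at most one term), and `0` if they lie in
different blocks. -/
noncomputable def lapOff (𝒢 : BlockDatum G R) (i j : V) : R :=
  ∑ e : Block G with i ∈ e.verts ∧ j ∈ e.verts, -(Ring.inverse (𝒢.a e) * 𝒢.multMat⁻¹ i j)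

/-- The additive-multiplicative Laplacian `L_𝒢`, whose columns sum to zero. -/
noncomputable def lapMat (𝒢 : BlockDatum G R) : Matrix V V R :=
  Matrix.of fun i j =>
    if i = j then -∑ k ∈ Finset.univ.erase j, 𝒢.lapOff k j else 𝒢.lapOff i j

end BlockDatum

/-! ### The clique model -/

section Clique

variable [DecidableEq V] {G : SimpleGraph V} [CommRing R]

/-- The block-datum with additive weights `a_e` and `(D*_{G_e})_{vw} = m_{e,v} m'_{e,w}` for
`v ≠ w` in the block `e` (only the values `m_{e,v}`, `m'_{e,v}` with `v ∈ e` are used). -/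
def cliqueDatum (a : Block G → R) (m m' : Block G → V → R) : BlockDatum G R where
  a := a
  Dstar e := Matrix.of fun v w => if v = w then 1 else m e v * m' e w
  diag e v := by simp

/-- `1 - m_{e,v} m'_{e,v}`. -/
def delta (m m' : Block G → V → R) (e : Block G) (v : V) : R :=
  1 - m e v * m' e v

/-- `e^T d_e = ∑_{v ∈ e} m_{e,v} m'_{e,v} / (1 - m_{e,v} m'_{e,v})`. -/
noncomputable def dSum (m m' : Block G → V → R) (e : Block G) : R :=
  ∑ v ∈ e.verts, m e v * m' e v * Ring.inverse (delta m m' e v)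

/-- `(1 + e^T d_e) ∏_{v ∈ e} (1 - m_{e,v} m'_{e,v})`, with the denominators in `d_e` cancelled
against the factors of the product. -/
def clearedDen (m m' : Block G → V → R) (e : Block G) : R :=
  ∏ v ∈ e.verts, delta m m' e v +
    ∑ v ∈ e.verts, m e v * m' e v * ∏ u ∈ e.verts.erase v, delta m m' e u

/-- The fraction `1 / (1 + e^T d_e)`, with numerator and denominator multiplied by
`∏_{u ∈ e} (1 - m_{e,u} m'_{e,u})`. -/
noncomputable def frac₁ (m m' : Block G → V → R) (e : Block G) : R :=
  Ring.inverse (clearedDen m m' e) * ∏ u ∈ e.verts, delta m m' e u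

/-- The fraction `1 / ((1 + e^T d_e) (1 - m_{e,v} m'_{e,v}) (1 - m_{e,w} m'_{e,w}))` for `v ≠ w`
in `e`, with numerator and denominator multiplied by
`∏_{u ∈ e ∖ {v, w}} (1 - m_{e,u} m'_{e,u})`. -/
noncomputable def frac₃ (m m' : Block G → V → R) (e : Block G) (v w : V) : R :=
  Ring.inverse (clearedDen m m' e) * ∏ u ∈ (e.verts.erase v).erase w, delta m m' e u

end Clique

/-- The contribution of a clique `e` with `p_e` vertices to `α_𝒢`:
`-a_e / (1 + e^T d_e)` times `p_e - 1` plus the sum over `v < w` in `e` of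
`(m_{e,v} - m_{e,w}) (m'_{e,v} - m'_{e,w}) / ((1 - m_{e,v} m'_{e,v}) (1 - m_{e,w} m'_{e,w}))`. -/
noncomputable def cliqueAlpha [LinearOrder V] {G : SimpleGraph V} [CommRing R]
    (a : Block G → R) (m m' : Block G → V → R) (e : Block G) : R :=
  -a e * (((e.verts.card : R) - 1) * frac₁ m m' e +
    ∑ v ∈ e.verts, ∑ w ∈ e.verts with v < w,
      (m e v - m e w) * (m' e v - m' e w) * frac₃ m m' e v w)

end AddMulGraph

/-! Everything reduces to single blocks through gates. For a block `e` and a vertex `x` there is one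
vertex `g = gate G e x` of `e` through which every walk from `x` to `e` passes (`exists_gate`). So
on the columns of `e` the row of `x` in D* is m_{xg} times the row of `g` in D*_e, and the same row
of D is an affine function of it. Two combinatorial facts glue the blocks: for `x ≠ y` exactly one
block through `y` has gate of `x` different from `y` (`sum_ite_gate_ne`), and the gate into `f` is
constant on every other block (`gate_eq_of_mem_of_ne`).

The first fact shows that the inverse of D* is the identity plus the sum over `e` of (D*_e)⁻¹ minus
the identity of `e` (`multMat_mul_multInv`). Hence τ_in and τ_out are sums over blocks, and τ_inᵀ D
= α eᵀ with α the sum of α_e = a_e (1 - eᵀ (D*_e)⁻¹ e) (`sum_tauIn_mul_distMat`). A row operation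
with coefficients τ_in then gives det D = α κ (`det_eq_mul_kappaAt`). The column differences of D
are D* times a matrix built from gates, which the second fact inverts explicitly; so κ is a unit
(`isUnit_kap`).

For the inverse two products suffice: D L = D* diag(τ_in) - 1 (`distMat_mul_lapMat`) and D (α⁻¹
τ_out eᵀ + C) = D* (`distMat_mul_eq_multMat`). Multiplying the second on the right by (D*)⁻¹ gives
one form; multiplying it by diag(τ_in) and subtracting the first gives the other.

Up to here the blocks are arbitrary. In the clique model D*_e is diagonal plus rank one, with
determinant N_e and an explicit adjugate (`clearedDen_mul_blockInv`); its column, row and total sums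
are the closed forms. Cliques matter only for identifying "not adjacent" with "in no common block".
-/

namespace AddMulGraph

set_option linter.unusedSectionVars false

/-! ### Betweenness -/

section Between

variable {V : Type*} {G : SimpleGraph V}

/-- Every walk from `x` to `y` passes through `v`. -/
def Between (G : SimpleGraph V) (x v y : V) : Prop :=
  ∀ p : G.Walk x y, v ∈ p.support

theorem between_left (x y : V) : Between G x x y := fun p => p.start_mem_support

theorem between_right (x y : V) : Between G x y y := fun p => p.end_mem_support

theorem Between.symm {x v y : V} (h : Between G x v y) : Between G y v x := fun p => by
  simpa using h p.reverse

/-- Two walks through `u` that both avoid `v` could be concatenated. -/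
theorem Between.or_of_mid {x v y : V} (h : Between G x v y) (u : V) :
    Between G x v u ∨ Between G u v y := by
  by_contra hc
  simp only [Between, not_or, not_forall] at hc
  obtain ⟨⟨p, hp⟩, q, hq⟩ := hc
  have := h (p.append q)
  rw [SimpleGraph.Walk.mem_support_append_iff] at this
  tauto

theorem Between.dist_add (hG : G.Connected) {x v y : V} (h : Between G x v y) :
    G.dist x v + G.dist v y = G.dist x y := by
  obtain ⟨p, hlen⟩ := hG.exists_walk_length_eq_dist x y
  have hv := h p
  have hsum : (p.takeUntil v hv).length + (p.dropUntil v hv).length = p.length := by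
    rw [← SimpleGraph.Walk.length_append, p.take_spec hv]
  have h1 := SimpleGraph.dist_le (p.takeUntil v hv)
  have h2 := SimpleGraph.dist_le (p.dropUntil v hv)
  have h3 := hG.dist_triangle (u := x) (v := v) (w := y)
  omega

theorem Between.antisymm (hG : G.Connected) {x v y : V} (h : Between G x v y)
    (h' : Between G x y v) : v = y := by
  have h1 := h.dist_add hG
  have h2 := h'.dist_add hG
  exact (hG.dist_eq_zero_iff).1 (by omega)

theorem Between.trans_right (hG : G.Connected) {x w v y : V} (h : Between G x v y)
    (h' : Between G x w v) : Between G w v y := by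
  rcases h.or_of_mid w with h1 | h1
  · rw [h1.antisymm hG h']; exact between_left _ _
  · exact h1

/-- The separating vertices are linearly ordered along the way from `x` to `y`: splitting at each of
the two leaves only the case in which both lie between the other one and `y`, and then they
coincide. -/
theorem Between.total (hG : G.Connected) {x v w y : V} (h : Between G x v y)
    (h' : Between G x w y) : Between G x v w ∨ Between G x w v := by
  rcases h.or_of_mid w with h1 | h1
  · exact Or.inl h1
  rcases h'.or_of_mid v with h2 | h2
  · exact Or.inr h2
  rw [h1.symm.antisymm hG h2.symm]
  exact Or.inl (between_right _ _)

theorem Separates.between {v i j : V} (h : Separates G v i j) : Between G i v j := h.2.2.2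

theorem Between.separates (hG : G.Connected) {v i j : V} (h : Between G i v j) (hi : v ≠ i)
    (hj : v ≠ j) : Separates G v i j :=
  ⟨hi, hj, hG.preconnected i j, h⟩

/-- `x` and `y` are joined by a walk inside `S`. -/
def JoinedIn (G : SimpleGraph V) (S : Set V) (x y : V) : Prop :=
  ∃ p : G.Walk x y, ∀ u ∈ p.support, u ∈ S

theorem JoinedIn.refl {S : Set V} {x : V} (hx : x ∈ S) : JoinedIn G S x x :=
  ⟨SimpleGraph.Walk.nil, by simpa using hx⟩

theorem JoinedIn.symm {S : Set V} {x y : V} : JoinedIn G S x y → JoinedIn G S y x := by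
  rintro ⟨p, hp⟩
  exact ⟨p.reverse, by simpa using hp⟩

theorem JoinedIn.trans {S : Set V} {x y z : V} :
    JoinedIn G S x y → JoinedIn G S y z → JoinedIn G S x z := by
  rintro ⟨p, hp⟩ ⟨q, hq⟩
  refine ⟨p.append q, fun u hu => ?_⟩
  rw [SimpleGraph.Walk.mem_support_append_iff] at hu
  exact hu.elim (hp u) (hq u)

theorem JoinedIn.mono {S T : Set V} {x y : V} (hST : S ⊆ T) :
    JoinedIn G S x y → JoinedIn G T x y := by
  rintro ⟨p, hp⟩
  exact ⟨p, fun u hu => hST (hp u hu)⟩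

theorem preconnected_induce_iff_joinedIn {S : Set V} :
    (G.induce S).Preconnected ↔ ∀ x ∈ S, ∀ y ∈ S, JoinedIn G S x y := by
  constructor
  · intro h x hx y hy
    obtain ⟨p⟩ := h ⟨x, hx⟩ ⟨y, hy⟩
    refine ⟨p.map (SimpleGraph.Embedding.induce S).toHom, fun u hu => ?_⟩
    have hu' : u ∈ p.support.map (SimpleGraph.Embedding.induce S).toHom :=
      (SimpleGraph.Walk.support_map _ p) ▸ hu
    obtain ⟨w, -, rfl⟩ := List.mem_map.1 hu'
    exact w.2
  · rintro h ⟨x, hx⟩ ⟨y, hy⟩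
    obtain ⟨p, hp⟩ := h x hx y hy
    exact ⟨p.induce S hp⟩

theorem preconnected_induce_of_center {S : Set V} (c : V)
    (h : ∀ x ∈ S, JoinedIn G S x c) : (G.induce S).Preconnected :=
  preconnected_induce_iff_joinedIn.2 fun x hx y hy => (h x hx).trans (h y hy).symm

end Between

/-! ### Blocks -/

section Block

variable {V : Type*} {G : SimpleGraph V}

/-- A connected vertex set without cut-vertices. -/
def NoCut (G : SimpleGraph V) (S : Set V) : Prop :=
  S.Nonempty ∧ (∀ x ∈ S, ∀ y ∈ S, JoinedIn G S x y) ∧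
    ∀ v, ∀ x ∈ S \ {v}, ∀ y ∈ S \ {v}, JoinedIn G (S \ {v}) x y

theorem noCut_iff {S : Set V} :
    ((G.induce S).Connected ∧ ∀ v ∈ S, ConnWithoutCut G S v) ↔ NoCut G S := by
  constructor
  · rintro ⟨h1, h2⟩
    have h3 := preconnected_induce_iff_joinedIn.1 h1.preconnected
    refine ⟨?_, h3, fun v => ?_⟩
    · obtain ⟨x⟩ := h1.nonempty
      exact ⟨x, x.2⟩
    · by_cases hv : v ∈ S
      · exact preconnected_induce_iff_joinedIn.1 (h2 v hv).2
      · rwa [Set.sdiff_singleton_eq_self hv]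
  · rintro ⟨⟨x, hx⟩, h1, h2⟩
    have h3 : (G.induce S).Connected :=
      { preconnected := preconnected_induce_iff_joinedIn.2 h1, nonempty := ⟨⟨x, hx⟩⟩ }
    exact ⟨h3, fun v _ => ⟨h3, preconnected_induce_iff_joinedIn.2 (h2 v)⟩⟩

theorem Block.noCut (e : Block G) : NoCut G (e.verts : Set V) :=
  noCut_iff.1 e.isBlock.prop

theorem Block.nonempty (e : Block G) : e.verts.Nonempty := by
  exact_mod_cast e.noCut.1

theorem Block.eq_of_noCut (e : Block G) {S : Set V} (hS : NoCut G S)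
    (h : (e.verts : Set V) ⊆ S) : (e.verts : Set V) = S :=
  e.isBlock.eq_of_subset (noCut_iff.2 hS) h

theorem Block.eq_of_subset {e f : Block G} (h : e.verts ⊆ f.verts) : e = f := by
  apply Block.ext
  exact_mod_cast e.eq_of_noCut f.noCut (by exact_mod_cast h)

theorem exists_block_of_noCut [Finite V] {S : Set V} (hS : NoCut G S) :
    ∃ e : Block G, S ⊆ (e.verts : Set V) := by
  obtain ⟨B, hSB, hB⟩ := (Set.toFinite
    {S : Set V | (G.induce S).Connected ∧ ∀ v ∈ S, ConnWithoutCut G S v}).exists_le_maximal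
    (noCut_iff.2 hS)
  refine ⟨⟨B.toFinite.toFinset, by simpa [IsBlock] using hB⟩, by simpa using hSB⟩

theorem noCut_singleton (x : V) : NoCut G {x} := by
  refine ⟨⟨x, rfl⟩, ?_, fun v => ?_⟩
  · rintro _ rfl _ rfl
    exact JoinedIn.refl rfl
  · rintro _ ⟨rfl, hx⟩ _ ⟨rfl, -⟩
    exact JoinedIn.refl ⟨rfl, hx⟩

theorem noCut_pair {x y : V} (h : G.Adj x y) : NoCut G {x, y} := by
  have key : JoinedIn G {x, y} x y := ⟨h.toWalk, by simp⟩
  refine ⟨⟨x, by simp⟩, ?_, fun v => ?_⟩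
  · rintro u (rfl | rfl) w (rfl | rfl)
    · exact JoinedIn.refl (by simp)
    · exact key
    · exact key.symm
    · exact JoinedIn.refl (by simp)
  · by_cases hv : v = x ∨ v = y
    · have : ∀ u ∈ ({x, y} : Set V) \ {v}, ∀ w ∈ ({x, y} : Set V) \ {v}, u = w := by
        rintro u ⟨rfl | rfl, hu⟩ w ⟨rfl | rfl, hw⟩ <;> simp_all <;>
          rcases hv with rfl | rfl <;> simp_all
      intro u hu w hw
      obtain rfl := this u hu w hw
      exact JoinedIn.refl hu
    · push Not at hv
      rw [Set.sdiff_singleton_eq_self (by simp [hv])]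
      rintro u (rfl | rfl) w (rfl | rfl)
      · exact JoinedIn.refl (by simp)
      · exact key
      · exact key.symm
      · exact JoinedIn.refl (by simp)

theorem exists_block_mem [Finite V] (x : V) : ∃ e : Block G, x ∈ e.verts := by
  obtain ⟨e, he⟩ := exists_block_of_noCut (noCut_singleton (G := G) x)
  exact ⟨e, by simpa using he⟩

theorem exists_block_of_adj [Finite V] {x y : V} (h : G.Adj x y) :
    ∃ e : Block G, x ∈ e.verts ∧ y ∈ e.verts := by
  obtain ⟨e, he⟩ := exists_block_of_noCut (noCut_pair h)
  exact ⟨e, by simpa using he (by simp : x ∈ _), by simpa using he (by simp : y ∈ _)⟩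

/-- Deleting one vertex leaves at least one of the two common vertices, which still connects the
union of the blocks; maximality then forces both blocks to equal the union. -/
theorem Block.eq_of_two_mem {e f : Block G} {x y : V} (hxy : x ≠ y) (hxe : x ∈ e.verts)
    (hye : y ∈ e.verts) (hxf : x ∈ f.verts) (hyf : y ∈ f.verts) : e = f := by
  have key : NoCut G ((e.verts : Set V) ∪ f.verts) := by
    obtain ⟨-, he1, he2⟩ := e.noCut
    obtain ⟨-, hf1, hf2⟩ := f.noCut
    refine ⟨⟨x, Or.inl hxe⟩, ?_, fun v => ?_⟩
    · rw [← preconnected_induce_iff_joinedIn]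
      refine preconnected_induce_of_center x ?_
      rintro z (hz | hz)
      · exact (he1 z hz x hxe).mono Set.subset_union_left
      · exact (hf1 z hz x hxf).mono Set.subset_union_right
    · obtain ⟨c, hcv, hce, hcf⟩ : ∃ c, c ≠ v ∧ c ∈ e.verts ∧ c ∈ f.verts := by
        by_cases hx : x = v
        · exact ⟨y, fun h => hxy (hx.trans h.symm), hye, hyf⟩
        · exact ⟨x, hx, hxe, hxf⟩
      rw [← preconnected_induce_iff_joinedIn]
      refine preconnected_induce_of_center c ?_
      rintro z ⟨hz | hz, hzv⟩
      · exact (he2 v z ⟨hz, hzv⟩ c ⟨hce, hcv⟩).mono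
          (Set.sdiff_subset_sdiff_left Set.subset_union_left)
      · exact (hf2 v z ⟨hz, hzv⟩ c ⟨hcf, hcv⟩).mono
          (Set.sdiff_subset_sdiff_left Set.subset_union_right)
  apply Block.ext
  have h1 := e.eq_of_noCut key Set.subset_union_left
  have h2 := f.eq_of_noCut key Set.subset_union_right
  exact_mod_cast h1.trans h2.symm

/-- A path with distinct end points in a block stays in this block. -/
theorem Block.support_subset_of_isPath (e : Block G) {x y : V} (hxy : x ≠ y)
    (hx : x ∈ e.verts) (hy : y ∈ e.verts) {p : G.Walk x y} (hp : p.IsPath) {u : V}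
    (hu : u ∈ p.support) : u ∈ e.verts := by
  have key : NoCut G ((e.verts : Set V) ∪ {w | w ∈ p.support}) := by
    obtain ⟨-, he1, he2⟩ := e.noCut
    refine ⟨⟨x, Or.inl hx⟩, ?_, fun v => ?_⟩
    · rw [← preconnected_induce_iff_joinedIn]
      refine preconnected_induce_of_center x ?_
      rintro z (hz | hz)
      · exact (he1 z hz x hx).mono Set.subset_union_left
      · exact JoinedIn.symm ⟨p.takeUntil z hz,
          fun w hw => Or.inr (p.support_takeUntil_subset_support hz hw)⟩
    · obtain ⟨c, hce, hcv, hc⟩ : ∃ c ∈ e.verts, c ≠ v ∧ ∀ z ∈ p.support, z ≠ v →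
          ∃ b ∈ e.verts, b ≠ v ∧
            JoinedIn G (((e.verts : Set V) ∪ {w | w ∈ p.support}) \ {v}) z b := by
        have h1 : ∃ c ∈ e.verts, c ≠ v := by
          by_cases h : x = v
          · exact ⟨y, hy, fun h' => hxy (h.trans h'.symm)⟩
          · exact ⟨x, hx, h⟩
        obtain ⟨c, hce, hcv⟩ := h1
        refine ⟨c, hce, hcv, fun z hz hzv => ?_⟩
        -- A path visits `v` only once, so one of its two halves at `z` avoids `v`; that half leads
        -- from `z` to an end point in the block.
        by_cases hv1 : v ∈ (p.takeUntil z hz).support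
        · have hv2 : v ∉ (p.dropUntil z hz).support := by
            intro hv2
            have hnd : ((p.takeUntil z hz).append (p.dropUntil z hz)).support.Nodup := by
              rw [p.take_spec hz]; exact hp.support_nodup
            rw [SimpleGraph.Walk.support_append, List.nodup_append] at hnd
            rw [SimpleGraph.Walk.mem_support_iff] at hv2
            rcases hv2 with rfl | hv2
            · exact hzv rfl
            · exact hnd.2.2 v hv1 v hv2 rfl
          refine ⟨y, hy, fun h => hv2 (h ▸ SimpleGraph.Walk.end_mem_support _),
            p.dropUntil z hz, fun w hw =>
              ⟨Or.inr (p.support_dropUntil_subset_support hz hw), fun h => hv2 (h ▸ hw)⟩⟩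
        · exact ⟨x, hx, fun h => hv1 (h ▸ SimpleGraph.Walk.start_mem_support _),
            JoinedIn.symm ⟨p.takeUntil z hz, fun w hw =>
              ⟨Or.inr (p.support_takeUntil_subset_support hz hw), fun h => hv1 (h ▸ hw)⟩⟩⟩
      rw [← preconnected_induce_iff_joinedIn]
      refine preconnected_induce_of_center c ?_
      have hin : ∀ z ∈ e.verts, z ≠ v →
          JoinedIn G (((e.verts : Set V) ∪ {w | w ∈ p.support}) \ {v}) z c := fun z hz hzv =>
        (he2 v z ⟨hz, hzv⟩ c ⟨hce, hcv⟩).mono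
          (Set.sdiff_subset_sdiff_left Set.subset_union_left)
      rintro z ⟨hz | hz, hzv⟩
      · exact hin z hz hzv
      · obtain ⟨b, hbe, hbv, hb⟩ := hc z hz hzv
        exact hb.trans (hin b hbe hbv)
  have h := e.eq_of_noCut key Set.subset_union_left
  have hu' : u ∈ ((e.verts : Set V) ∪ {w | w ∈ p.support}) := Or.inr hu
  rw [← h] at hu'
  exact hu'

theorem Block.eq_or_eq_of_between (e : Block G) {x v y : V} (hx : x ∈ e.verts)
    (hy : y ∈ e.verts) (h : Between G x v y) : v = x ∨ v = y := by
  by_contra hc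
  push Not at hc
  obtain ⟨p, hp⟩ := e.noCut.2.2 v x ⟨hx, hc.1.symm⟩ y ⟨hy, hc.2.symm⟩
  exact (hp v (h p)).2 rfl

/-- A block contained in {i} would lie inside the block of an edge at `i`, contradicting maximality.
-/
theorem Block.exists_ne_of_mem [Finite V] (hG : G.Connected) {e : Block G} {i j : V}
    (hij : j ≠ i) : ∃ z ∈ e.verts, z ≠ i := by
  by_contra hc
  push Not at hc
  have : Nontrivial V := ⟨⟨j, i, hij⟩⟩
  obtain ⟨k, hk⟩ := hG.preconnected.exists_adj_of_nontrivial i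
  obtain ⟨f, hif, hkf⟩ := exists_block_of_adj hk
  have hef : e = f := Block.eq_of_subset fun z hz => by rwa [hc z hz]
  exact hk.ne (hc k (hef ▸ hkf)).symm

end Block

/-! ### Gates -/

section Gate

variable {V : Type*} {G : SimpleGraph V}

/-- The gate is a vertex of `e` nearest to `x`. If a walk from `x` to `z` missed it, going back
along a geodesic and then along that walk would give a path from `g` to `z`, which stays in `e`. Its
first edge lies neither on the geodesic, which meets `e` only in `g`, nor on the walk, which misses
`g`. -/
theorem exists_gate (hG : G.Connected) (e : Block G) (x : V) :
    ∃ g ∈ e.verts, ∀ z ∈ e.verts, Between G x g z := by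
  obtain ⟨g, hg, hmin⟩ := e.verts.exists_min_image (fun z => G.dist x z) e.nonempty
  refine ⟨g, hg, fun z hz p => ?_⟩
  by_contra hgp
  obtain ⟨q, hq⟩ := hG.exists_walk_length_eq_dist x g
  have hq' : ∀ u ∈ q.support, u ∈ e.verts → u = g := by
    intro u hu hue
    have hsum : (q.takeUntil u hu).length + (q.dropUntil u hu).length = q.length := by
      rw [← SimpleGraph.Walk.length_append, q.take_spec hu]
    have h1 := SimpleGraph.dist_le (q.takeUntil u hu)
    have h2 := hmin u hue
    exact SimpleGraph.Walk.eq_of_length_eq_zero (p := q.dropUntil u hu) (by omega)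
  have hgz : g ≠ z := fun h => hgp (h ▸ p.end_mem_support)
  set w := q.reverse.append p with hw
  have hpath := w.bypass_isPath
  have hsub := fun u (hu : u ∈ w.bypass.support) =>
    e.support_subset_of_isPath hgz hg hz hpath hu
  have hedge := w.edges_bypass_subset_edges
  cases hb : w.bypass with
  | nil => exact hgz rfl
  | @cons _ y _ hadj r =>
    rw [hb] at hsub hedge
    have hy : y ∈ e.verts := hsub y (by simp)
    have hmem : s(g, y) ∈ w.edges := hedge (by simp)
    rw [hw, SimpleGraph.Walk.edges_append, List.mem_append] at hmem
    rcases hmem with hmem | hmem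
    · have : y ∈ q.support := by
        simpa using SimpleGraph.Walk.snd_mem_support_of_mem_edges _ hmem
      exact hadj.ne (hq' y this hy).symm
    · exact hgp (SimpleGraph.Walk.fst_mem_support_of_mem_edges _ hmem)

/-- The vertex of the block `e` through which `x` is attached to `e`. -/
noncomputable def gate (G : SimpleGraph V) (e : Block G) (x : V) : V :=
  if h : ∃ g ∈ e.verts, ∀ z ∈ e.verts, Between G x g z then h.choose else x

theorem gate_mem (hG : G.Connected) (e : Block G) (x : V) : gate G e x ∈ e.verts := by
  rw [gate, dif_pos (exists_gate hG e x)]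
  exact (exists_gate hG e x).choose_spec.1

theorem between_gate (hG : G.Connected) (e : Block G) (x : V) {z : V} (hz : z ∈ e.verts) :
    Between G x (gate G e x) z := by
  rw [gate, dif_pos (exists_gate hG e x)]
  exact (exists_gate hG e x).choose_spec.2 z hz

theorem gate_eq (hG : G.Connected) {e : Block G} {x g : V} (hg : g ∈ e.verts)
    (h : ∀ z ∈ e.verts, Between G x g z) : gate G e x = g :=
  (between_gate hG e x hg).antisymm hG (h _ (gate_mem hG e x))

theorem gate_of_mem (hG : G.Connected) {e : Block G} {x : V} (hx : x ∈ e.verts) :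
    gate G e x = x :=
  gate_eq hG hx fun z _ => between_left x z

/-- If the gates differ, each of them lies between `x` and `y`, hence is `x` or `y` because `e` has
no cut-vertex. Then `e` and `f` share two vertices. -/
theorem gate_eq_of_mem_of_ne (hG : G.Connected) {e f : Block G} (hef : e ≠ f) {x y : V}
    (hx : x ∈ e.verts) (hy : y ∈ e.verts) : gate G f x = gate G f y := by
  by_contra hne
  have hgx := gate_mem hG f x
  have hgy := gate_mem hG f y
  have key : ∀ u v : V, gate G f u ≠ gate G f v → Between G u (gate G f u) v := by
    intro u v huv
    rcases (between_gate hG f u (gate_mem hG f v)).or_of_mid v with h | h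
    · exact h
    · exact absurd (h.antisymm hG (between_gate hG f v (gate_mem hG f u))) huv
  have h1 := e.eq_or_eq_of_between hx hy (key x y hne)
  have h2 := e.eq_or_eq_of_between hy hx (key y x (Ne.symm hne))
  refine hef (Block.eq_of_two_mem hne ?_ ?_ hgx hgy)
  · rcases h1 with h | h <;> rwa [h]
  · rcases h2 with h | h <;> rwa [h]

theorem gate_gate_of_ne (hG : G.Connected) {e f : Block G} (hef : e ≠ f) (x y : V) :
    gate G f (gate G e x) = gate G f (gate G e y) :=
  gate_eq_of_mem_of_ne hG hef (gate_mem hG e x) (gate_mem hG e y)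

/-- The block of the first edge on a geodesic from `y` to `x` works, since its other end is closer
to `x`. -/
theorem exists_gate_ne [Finite V] (hG : G.Connected) {x y : V} (hxy : x ≠ y) :
    ∃ e : Block G, y ∈ e.verts ∧ gate G e x ≠ y := by
  obtain ⟨p, hlen⟩ := hG.exists_walk_length_eq_dist y x
  cases p with
  | nil => exact absurd rfl hxy
  | @cons _ z _ hadj r =>
    obtain ⟨e, hye, hze⟩ := exists_block_of_adj hadj
    refine ⟨e, hye, fun h => ?_⟩
    have h1 := (between_gate hG e x hze).dist_add hG
    rw [h] at h1
    have h2 := SimpleGraph.dist_le r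
    rw [SimpleGraph.Walk.length_cons, G.dist_comm] at hlen
    rw [G.dist_comm] at h2
    omega

/-- For distinct blocks both gates lie between `x` and `y`, so one comes first. From that one the
other block is entered at `y`, so `y` would precede the second gate. -/
theorem eq_of_gate_ne (hG : G.Connected) {x y : V} {e f : Block G} (he : y ∈ e.verts)
    (hf : y ∈ f.verts) (hxe : gate G e x ≠ y) (hxf : gate G f x ≠ y) : e = f := by
  by_contra hef
  have aux : ∀ e f : Block G, e ≠ f → y ∈ e.verts → y ∈ f.verts → gate G f x ≠ y →
      ¬ Between G x (gate G e x) (gate G f x) := by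
    intro e f hef he hf hxf hb
    have h1 := (between_gate hG f x hf).trans_right hG hb
    have h2 : gate G f (gate G e x) = y := by
      rw [gate_eq_of_mem_of_ne hG hef (gate_mem hG e x) he, gate_of_mem hG hf]
    have h3 := between_gate hG f (gate G e x) (gate_mem hG f x)
    rw [h2] at h3
    exact hxf (h1.antisymm hG h3)
  rcases (between_gate hG e x he).total hG (between_gate hG f x hf) with h | h
  · exact aux e f hef he hf hxf h
  · exact aux f e (Ne.symm hef) hf he hxe h

/-- Otherwise the rest of the geodesic from `u` to the gate of `j` would pass through `i`, making
`i` closer to `j` than the gate. -/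
theorem gate_ne_of_mem_geodesic (hG : G.Connected) {e : Block G} {i j u : V}
    (hi : i ∈ e.verts) (hj : gate G e j ≠ i) {p : G.Walk j (gate G e j)}
    (hp : p.length = G.dist j (gate G e j)) (hu : u ∈ p.support) : gate G e u ≠ i := by
  intro hui
  have h1 := (between_gate hG e j hi).dist_add hG
  have h2 := (between_gate hG e u (gate_mem hG e j)).dist_add hG
  rw [hui] at h2
  have hsum : (p.takeUntil u hu).length + (p.dropUntil u hu).length = p.length := by
    rw [← SimpleGraph.Walk.length_append, p.take_spec hu]
  have h3 := SimpleGraph.dist_le (p.takeUntil u hu)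
  have h4 := SimpleGraph.dist_le (p.dropUntil u hu)
  have h5 := hG.dist_triangle (u := j) (v := u) (w := i)
  have h6 := hG.pos_dist_of_ne hj
  have h7 := G.dist_comm (u := i) (v := gate G e j)
  omega

/-- If the gate of `j ≠ i` is `i`, deleting `i` cuts `j` off from the rest of `e`. Conversely the
right-hand set is itself admissible: geodesics join its points to their gates, and `e` minus `i` is
connected. -/
theorem mem_branch_iff [Finite V] (hG : G.Connected) {e : Block G} {i j : V}
    (hi : i ∈ e.verts) : j ∈ branch G i e ↔ j = i ∨ gate G e j ≠ i := by
  constructor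
  · rintro ⟨S, ⟨heS, -, hS⟩, hjS⟩
    rw [preconnected_induce_iff_joinedIn] at hS
    by_cases hji : j = i
    · exact Or.inl hji
    right
    intro hg
    obtain ⟨z, hz, hzi⟩ := Block.exists_ne_of_mem (e := e) hG hji
    obtain ⟨p, hp⟩ := hS j ⟨hjS, hji⟩ z ⟨heS hz, hzi⟩
    have := between_gate hG e j hz p
    rw [hg] at this
    exact (hp i this).2 rfl
  · intro hj
    have hcenter : ∀ u, gate G e u ≠ i →
        JoinedIn G ({k | k = i ∨ gate G e k ≠ i} \ {i}) u (gate G e u) := by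
      intro u hu
      obtain ⟨p, hp⟩ := hG.exists_walk_length_eq_dist u (gate G e u)
      refine ⟨p, fun w hw => ?_⟩
      have hwi := gate_ne_of_mem_geodesic hG hi hu hp hw
      exact ⟨Or.inr hwi, fun h => hwi (by rw [h, gate_of_mem hG hi])⟩
    have heS : (e.verts : Set V) ⊆ {k | k = i ∨ gate G e k ≠ i} := by
      intro k hk
      rw [Set.mem_ofPred_eq, gate_of_mem hG hk]
      exact em _
    refine ⟨{k | k = i ∨ gate G e k ≠ i}, ⟨heS, ?_, ?_⟩, hj⟩
    · refine { preconnected := preconnected_induce_of_center i ?_, nonempty := ⟨⟨i, Or.inl rfl⟩⟩ }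
      rintro k (rfl | hk)
      · exact JoinedIn.refl (Or.inl rfl)
      · exact ((hcenter k hk).mono Set.sdiff_subset).trans
          ((e.noCut.2.1 _ (gate_mem hG e k) i hi).mono heS)
    · rw [preconnected_induce_iff_joinedIn]
      rintro k ⟨hk, hki⟩ l ⟨hl, hli⟩
      have hk' := hk.resolve_left hki
      have hl' := hl.resolve_left hli
      exact ((hcenter k hk').trans ((e.noCut.2.2 i _ ⟨gate_mem hG e k, hk'⟩ _
        ⟨gate_mem hG e l, hl'⟩).mono (Set.sdiff_subset_sdiff_left heS))).trans
        (hcenter l hl').symm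

theorem subset_branch_iff_mem [Finite V] (hG : G.Connected) {e f : Block G} {i j : V}
    (hi : i ∈ e.verts) (hj : j ∈ f.verts) (hji : j ≠ i) :
    (f.verts : Set V) ⊆ branch G i e ↔ j ∈ branch G i e := by
  refine ⟨fun h => h hj, fun h k hk => ?_⟩
  rw [mem_branch_iff hG hi] at h ⊢
  have hk' : k ∈ f.verts := hk
  by_cases hef : f = e
  · subst hef
    rw [gate_of_mem hG hk']
    exact em _
  · right
    rw [gate_eq_of_mem_of_ne hG hef hk' hj]
    exact h.resolve_left hji

theorem subset_branch_iff_eq [Finite V] (hG : G.Connected) {e f : Block G} {i : V}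
    (hi : i ∈ e.verts) (hif : i ∈ f.verts) :
    (f.verts : Set V) ⊆ branch G i e ↔ e = f := by
  constructor
  · intro h
    by_contra hef
    by_cases hz : ∃ z ∈ f.verts, z ≠ i
    · obtain ⟨z, hz, hzi⟩ := hz
      have h1 := h hz
      rw [mem_branch_iff hG hi, gate_eq_of_mem_of_ne hG (Ne.symm hef) hz hif,
        gate_of_mem hG hi] at h1
      exact h1.elim hzi (fun h => h rfl)
    · push Not at hz
      exact hef (Block.eq_of_subset (e := f) (f := e) fun z hzf => by rwa [hz z hzf]).symm
  · rintro rfl k hk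
    rw [mem_branch_iff hG hi, gate_of_mem hG hk]
    exact em _

end Gate

/-! ### Sums over blocks -/

section Sums

variable {V : Type*} [Fintype V] [DecidableEq V] {G : SimpleGraph V} {R : Type*} [CommRing R]

/-- This count (one block if `x ≠ y`, none if `x = y`) turns sums over blocks back into single
matrix entries. -/
theorem sum_ite_gate_ne (hG : G.Connected) (x y : V) (c : R) :
    ∑ e : Block G, (if y ∈ e.verts ∧ gate G e x ≠ y then c else 0) =
      if x = y then 0 else c := by
  split_ifs with hxy
  · subst hxy
    refine Finset.sum_eq_zero fun e _ => if_neg ?_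
    rintro ⟨h, h'⟩
    exact h' (gate_of_mem hG h)
  · obtain ⟨e, he, hne⟩ := exists_gate_ne hG hxy
    rw [Finset.sum_eq_single e]
    · rw [if_pos ⟨he, hne⟩]
    · intro f _ hfe
      refine if_neg ?_
      rintro ⟨h, h'⟩
      exact hfe (eq_of_gate_ne hG h he h' hne)
    · simp

/-- A sum over the vertices, grouped by the blocks as seen from `x`. -/
theorem sum_eq_sum_block (hG : G.Connected) (x : V) (F : V → R) :
    ∑ y, F y = F x + ∑ e : Block G, (∑ y ∈ e.verts, F y - F (gate G e x)) := by
  have h1 : ∀ e : Block G, ∑ y ∈ e.verts, F y - F (gate G e x) =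
      ∑ y, if y ∈ e.verts ∧ gate G e x ≠ y then F y else 0 := by
    intro e
    rw [← Finset.add_sum_erase _ _ (gate_mem hG e x), add_sub_cancel_left, ← Finset.sum_filter]
    refine Finset.sum_congr ?_ fun _ _ => rfl
    ext y
    simp [and_comm, eq_comm]
  simp_rw [h1]
  rw [Finset.sum_comm]
  simp_rw [sum_ite_gate_ne hG]
  rw [← Finset.add_sum_erase _ _ (Finset.mem_univ x),
    ← Finset.add_sum_erase (s := Finset.univ) (a := x) (f := fun y => if x = y then 0 else F y) (Finset.mem_univ x)]
  simp only [if_true, zero_add]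
  congr 1
  refine Finset.sum_congr rfl fun y hy => ?_
  rw [if_neg (Finset.ne_of_mem_erase hy).symm]

end Sums

/-! ### The distance matrices along gates -/

namespace BlockDatum

variable {V : Type*} {G : SimpleGraph V} {R : Type*} [CommRing R] (𝒢 : BlockDatum G R)

theorem multDist_eq_Dstar {e : Block G} {x y : V} (hx : x ∈ e.verts) (hy : y ∈ e.verts) :
    𝒢.multDist x y = 𝒢.Dstar e ⟨x, hx⟩ ⟨y, hy⟩ := by
  have h : ∃ e : Block G, x ∈ e.verts ∧ y ∈ e.verts := ⟨e, hx, hy⟩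
  rw [multDist, dif_pos h]
  by_cases hxy : x = y
  · subst hxy
    rw [𝒢.diag, 𝒢.diag]
  · have he : h.choose = e :=
      Block.eq_of_two_mem hxy h.choose_spec.1 h.choose_spec.2 hx hy
    subst he
    rfl

theorem addMultDist_eq_of_mem {e : Block G} {x y : V} (hx : x ∈ e.verts) (hy : y ∈ e.verts) :
    𝒢.addMultDist x y = 𝒢.a e * (𝒢.multDist x y - 1) := by
  have h : ∃ e : Block G, x ∈ e.verts ∧ y ∈ e.verts := ⟨e, hx, hy⟩
  rw [𝒢.multDist_eq_Dstar hx hy, addMultDist, dif_pos h]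
  by_cases hxy : x = y
  · subst hxy
    rw [𝒢.diag, 𝒢.diag]
    simp
  · have he : h.choose = e :=
      Block.eq_of_two_mem hxy h.choose_spec.1 h.choose_spec.2 hx hy
    subst he
    rfl

theorem multDist_self [Finite V] (x : V) : 𝒢.multDist x x = 1 := by
  obtain ⟨e, he⟩ := exists_block_mem (G := G) x
  rw [𝒢.multDist_eq_Dstar he he, 𝒢.diag]

theorem addMultDist_self [Finite V] (x : V) : 𝒢.addMultDist x x = 0 := by
  obtain ⟨e, he⟩ := exists_block_mem (G := G) x
  rw [𝒢.addMultDist_eq_of_mem he he, 𝒢.multDist_self, sub_self, mul_zero]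

theorem _root_.AddMulGraph.Separates.not_exists_block {v i j : V} (h : Separates G v i j) :
    ¬ ∃ e : Block G, i ∈ e.verts ∧ j ∈ e.verts := by
  rintro ⟨e, hi, hj⟩
  exact (e.eq_or_eq_of_between hi hj h.between).elim h.1 h.2.1

/-- The recursive definitions pick some separating vertex `w`; this is independence of the choice.
As `v` and `w` are ordered along the way, induction on the distance splits the entries at both. -/
theorem dist_of_separates (hG : G.Connected) (n : ℕ) : ∀ i j v : V, G.dist i j = n →
    Separates G v i j →
    𝒢.multDist i j = 𝒢.multDist i v * 𝒢.multDist v j ∧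
      𝒢.addMultDist i j = 𝒢.addMultDist i v + 𝒢.multDist i v * 𝒢.addMultDist v j := by
  induction n using Nat.strong_induction_on with
  | _ n ih =>
  rintro i j v rfl hv
  have h : ∃ v, Separates G v i j := ⟨v, hv⟩
  rw [multDist.eq_1 𝒢 i j, addMultDist.eq_1 𝒢 i j, dif_neg hv.not_exists_block,
    dif_neg hv.not_exists_block, dif_pos h, dif_pos h]
  have hw : Separates G h.choose i j := h.choose_spec
  revert hw
  generalize h.choose = w
  intro hw
  by_cases hvw : v = w
  · subst hvw
    exact ⟨rfl, rfl⟩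
  rcases hv.between.total hG hw.between with hb | hb
  · have h1 := ih _ hw.dist_add.1 i w v rfl (hb.separates hG hv.1 hvw)
    have h2 := ih _ hv.dist_add.2 v j w rfl
      ((hw.between.trans_right hG hb).separates hG (Ne.symm hvw) hw.2.1)
    rw [h1.1, h1.2, h2.1, h2.2]
    constructor <;> ring
  · have h1 := ih _ hv.dist_add.1 i v w rfl (hb.separates hG hw.1 (Ne.symm hvw))
    have h2 := ih _ hw.dist_add.2 w j v rfl
      ((hv.between.trans_right hG hb).separates hG hvw hv.2.1)
    rw [h1.1, h1.2, h2.1, h2.2]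
    constructor <;> ring

theorem dist_of_between [Finite V] (hG : G.Connected) {i v j : V} (h : Between G i v j) :
    𝒢.multDist i j = 𝒢.multDist i v * 𝒢.multDist v j ∧
      𝒢.addMultDist i j = 𝒢.addMultDist i v + 𝒢.multDist i v * 𝒢.addMultDist v j := by
  by_cases hi : v = i
  · subst hi
    simp [multDist_self, addMultDist_self]
  by_cases hj : v = j
  · subst hj
    simp [multDist_self, addMultDist_self]
  exact 𝒢.dist_of_separates hG _ i j v rfl (h.separates hG hi hj)

variable [Finite V] (hG : G.Connected) (e : Block G) (x : V)

include hG

theorem multDist_gate {z : V} (hz : z ∈ e.verts) :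
    𝒢.multDist x z = 𝒢.multDist x (gate G e x) * 𝒢.multDist (gate G e x) z :=
  (𝒢.dist_of_between hG (between_gate hG e x hz)).1

theorem addMultDist_gate {z : V} (hz : z ∈ e.verts) :
    𝒢.addMultDist x z = 𝒢.addMultDist x (gate G e x) +
      𝒢.multDist x (gate G e x) * (𝒢.a e * (𝒢.multDist (gate G e x) z - 1)) := by
  rw [(𝒢.dist_of_between hG (between_gate hG e x hz)).2,
    𝒢.addMultDist_eq_of_mem (gate_mem hG e x) hz]

theorem addMultDist_gate' {z : V} (hz : z ∈ e.verts) :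
    𝒢.addMultDist z x = 𝒢.a e * (𝒢.multDist z (gate G e x) - 1) +
      𝒢.multDist z (gate G e x) * 𝒢.addMultDist (gate G e x) x := by
  rw [(𝒢.dist_of_between hG (between_gate hG e x hz).symm).2,
    𝒢.addMultDist_eq_of_mem hz (gate_mem hG e x)]

end BlockDatum

/-! ### Determinants and the invariant `κ` -/

section Determinant

variable {n : Type*} [Fintype n] [DecidableEq n] {R : Type*} [CommRing R]

/-- Subtracting the last column from the others and then `m` times the last row from the rows above
gives the corner `K`. Adding the `t`-combination of the upper rows to the last row turns the latter
into (0, α). -/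
theorem det_fromBlocks_unit (A : Matrix n n R) (u m w t : n → R) (δ τ₀ α : R)
    (h1 : ∀ y, ∑ x, t x * A x y + τ₀ * w y = α) (h2 : ∑ x, t x * u x + τ₀ * δ = α)
    (h3 : ∑ x, t x * m x + τ₀ = 1) :
    (fromBlocks A (of fun x (_ : Unit) => u x) (of fun (_ : Unit) y => w y)
      (of fun _ _ => δ)).det =
      α * (of fun x y => A x y - u x - m x * (w y - δ)).det := by
  set K : Matrix n n R := of fun x y => A x y - u x - m x * (w y - δ) with hK
  have hfac : fromBlocks A (of fun x (_ : Unit) => u x) (of fun (_ : Unit) y => w y)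
      (of fun _ _ => δ) =
      fromBlocks 1 (of fun x (_ : Unit) => m x) 0 1 *
        (fromBlocks K (of fun x (_ : Unit) => u x - m x * δ) (of fun (_ : Unit) y => w y - δ)
          (of fun _ _ => δ) *
        fromBlocks 1 0 (of fun _ _ => 1) 1) := by
    simp only [fromBlocks_multiply]
    congr 1 <;> ext x y <;> simp [Matrix.mul_apply, hK]
    ring
  have hrow : fromBlocks 1 0 (of fun (_ : Unit) y => t y) 1 *
      fromBlocks K (of fun x (_ : Unit) => u x - m x * δ) (of fun (_ : Unit) y => w y - δ)
          (of fun _ _ => δ) =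
      fromBlocks K (of fun x (_ : Unit) => u x - m x * δ) 0 (of fun _ _ => α) := by
    simp only [fromBlocks_multiply]
    congr 1
    · simp
    · simp
    · ext x y
      simp only [Matrix.add_apply, Matrix.mul_apply, of_apply, hK, Matrix.one_mul, Matrix.zero_apply]
      have : ∑ i, t i * (A i y - u i - m i * (w y - δ)) =
          ∑ i, t i * A i y - ∑ i, t i * u i - (∑ i, t i * m i) * (w y - δ) := by
        rw [Finset.sum_mul, ← Finset.sum_sub_distrib, ← Finset.sum_sub_distrib]
        exact Finset.sum_congr rfl fun i _ => by ring
      rw [this]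
      linear_combination h1 y - h2 - (w y - δ) * h3
    · ext x y
      simp only [Matrix.add_apply, Matrix.mul_apply, of_apply, Matrix.one_mul]
      have : ∑ i, t i * (u i - m i * δ) = ∑ i, t i * u i - (∑ i, t i * m i) * δ := by
        rw [Finset.sum_mul, ← Finset.sum_sub_distrib]
        exact Finset.sum_congr rfl fun i _ => by ring
      rw [this]
      linear_combination h2 - δ * h3
  have hdet := congrArg Matrix.det hrow
  rw [det_mul, det_fromBlocks_zero₁₂, det_fromBlocks_zero₂₁, det_one, det_one, one_mul,
    one_mul, det_unique (of fun _ _ => α)] at hdet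
  rw [hfac, det_mul, det_mul, det_fromBlocks_zero₂₁, det_fromBlocks_zero₁₂, det_one, det_one,
    hdet]
  simp [mul_comm]

/-- The indices different from `v₀`, together with `v₀`. -/
noncomputable def sumUnitEquiv (v₀ : n) : {x : n // x ≠ v₀} ⊕ Unit ≃ n :=
  (Equiv.optionEquivSumPUnit _).symm.trans (Equiv.optionSubtypeNe v₀)

theorem det_eq_det_fromBlocks (D : Matrix n n R) (v₀ : n) :
    D.det = (fromBlocks (of fun x y : {x : n // x ≠ v₀} => D x y)
      (of fun x (_ : Unit) => D (x : n) v₀) (of fun (_ : Unit) y => D v₀ (y : n))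
      (of fun _ _ => D v₀ v₀)).det := by
  rw [← det_submatrix_equiv_self (sumUnitEquiv v₀) D]
  congr 1
  ext (x | x) (y | y) <;> simp [sumUnitEquiv]

theorem sum_eq_sum_ne_add (F : n → R) (v₀ : n) :
    ∑ x, F x = ∑ x : {x : n // x ≠ v₀}, F x + F v₀ := by
  rw [← (sumUnitEquiv v₀).sum_comp, Fintype.sum_sum_type]
  simp [sumUnitEquiv]

theorem det_eq_mul_det {D M : Matrix n n R} {τ : n → R} {α : R} (v₀ : n)
    (h1 : ∀ y, ∑ x, τ x * D x y = α) (h2 : ∑ x, τ x * M x v₀ = 1) (h3 : M v₀ v₀ = 1) :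
    D.det = α * (of fun x y : {x : n // x ≠ v₀} =>
      D x y - D x v₀ - M x v₀ * (D v₀ y - D v₀ v₀)).det := by
  rw [det_eq_det_fromBlocks D v₀]
  refine det_fromBlocks_unit (of fun x y : {x : n // x ≠ v₀} => D x y) (fun x => D x v₀)
    (fun x => M x v₀) (fun y => D v₀ y) (fun x => τ x) (D v₀ v₀) (τ v₀) α ?_ ?_ ?_
  · intro y
    rw [← h1 y, sum_eq_sum_ne_add _ v₀]
    rfl
  · rw [← h1 v₀, sum_eq_sum_ne_add _ v₀]
  · rw [← h2, sum_eq_sum_ne_add _ v₀, h3, mul_one]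

theorem det_eq_mul_kappaAt {D M : Matrix n n R} {τ : n → R} {α : R} (v₀ : n)
    (h1 : ∀ y, ∑ x, τ x * D x y = α) (h2 : ∀ y, ∑ x, τ x * M x y = 1)
    (hM : ∀ x, M x x = 1) (hD : ∀ x, D x x = 0) :
    D.det = α * kappaAt D M v₀ := by
  rw [det_eq_mul_det v₀ h1 (h2 v₀) (hM v₀), kappaAt]
  simp only [hD, sub_zero]

/-- Adding column `v₁` of `M` to every column of `D` leaves the reduced matrix at `v₀` unchanged and
raises `α` by one. The right-hand side does not involve `v₀`, so κ is independent of the base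
vertex. -/
theorem kappaAt_eq_sub {D M : Matrix n n R} {τ : n → R} {α : R} (v₀ v₁ : n)
    (h1 : ∀ y, ∑ x, τ x * D x y = α) (h2 : ∀ y, ∑ x, τ x * M x y = 1)
    (hM : ∀ x, M x x = 1) (hD : ∀ x, D x x = 0) :
    kappaAt D M v₀ = (of fun x y => D x y + M x v₁).det - D.det := by
  have h3 : ∀ y, ∑ x, τ x * (of fun x y => D x y + M x v₁) x y = α + 1 := by
    intro y
    simp only [of_apply, mul_add, Finset.sum_add_distrib, h1, h2]
  rw [det_eq_mul_kappaAt v₀ h1 h2 hM hD, det_eq_mul_det v₀ h3 (h2 v₀) (hM v₀), kappaAt]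
  have : (of fun x y : {x : n // x ≠ v₀} => (of fun x y => D x y + M x v₁) (x : n) (y : n) -
      (of fun x y => D x y + M x v₁) (x : n) v₀ - M x v₀ *
        ((of fun x y => D x y + M x v₁) v₀ (y : n) - (of fun x y => D x y + M x v₁) v₀ v₀)) =
      of fun x y : {x : n // x ≠ v₀} => D x y - D x v₀ - M x v₀ * D v₀ y := by
    ext x y
    simp only [of_apply, hD]
    ring
  rw [this]
  ring

theorem kappaAt_eq_kappa {D M : Matrix n n R} {τ : n → R} {α : R} (v₀ : n)
    (h1 : ∀ y, ∑ x, τ x * D x y = α) (h2 : ∀ y, ∑ x, τ x * M x y = 1)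
    (hM : ∀ x, M x x = 1) (hD : ∀ x, D x x = 0) :
    kappaAt D M v₀ = kappa D M := by
  rw [kappa, dif_pos ⟨v₀⟩, kappaAt_eq_sub v₀ v₀ h1 h2 hM hD, kappaAt_eq_sub _ v₀ h1 h2 hM hD]

/-- Condensation at an entry equal to `1`. -/
theorem det_eq_det_condensed (M : Matrix n n R) (v₀ : n) (h : M v₀ v₀ = 1) :
    M.det = (of fun x y : {x : n // x ≠ v₀} => M x y - M x v₀ * M v₀ y).det := by
  rw [det_eq_det_fromBlocks M v₀, h]
  have h1 : (of fun _ _ => 1 : Matrix Unit Unit R) = 1 := by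
    ext
    simp
  rw [h1, det_fromBlocks_one₂₂]
  congr 1
  ext x y
  simp [Matrix.mul_apply]

/-- If the column differences of `D` are `M * H`, then `κ` is a product of determinants. -/
theorem kappaAt_eq_det_mul_det {D M H : Matrix n n R} (v₀ : n)
    (hM : M v₀ v₀ = 1) (hD : D v₀ v₀ = 0)
    (h : ∀ x y, D x y - D x v₀ = ∑ z, M x z * H z y) :
    kappaAt D M v₀ = M.det * (of fun x y : {x : n // x ≠ v₀} => H x y).det := by
  rw [det_eq_det_condensed M v₀ hM, ← det_mul, kappaAt]
  congr 1
  ext x y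
  have h0 := h v₀ y
  rw [hD, sub_zero] at h0
  rw [of_apply, h, h0, Matrix.mul_apply, sum_eq_sum_ne_add _ v₀,
    sum_eq_sum_ne_add (fun z => M v₀ z * H z y) v₀, hM]
  simp only [of_apply, sub_mul, Finset.sum_sub_distrib, mul_add, Finset.mul_sum, mul_assoc]
  ring

end Determinant

namespace BlockDatum

variable {V : Type*} [Fintype V] [DecidableEq V] {G : SimpleGraph V} {R : Type*} [CommRing R]
  (𝒢 : BlockDatum G R)

/-! ### The inverses of the blocks -/

/-- The columns of `e` in D* factor as a matrix supported on the pairs (x, gate of x) times D*_e.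
Multiplying that factor by the rows of `e` in (D*)⁻¹ gives a left inverse. -/
theorem isUnit_det_Dstar (hG : G.Connected) (hM : IsUnit 𝒢.multMat.det) (e : Block G) :
    IsUnit (𝒢.Dstar e).det := by
  refine Matrix.isUnit_det_of_left_inverse (B := of fun w h : e.verts =>
    ∑ x, 𝒢.multMat⁻¹ w x * if gate G e x = h then 𝒢.multDist x h else 0) ?_
  ext w z
  have h1 := congrFun (congrFun (Matrix.nonsing_inv_mul _ hM) w) z
  simp only [Matrix.mul_apply, of_apply, Finset.sum_mul] at h1 ⊢
  rw [Finset.sum_comm]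
  have h2 : ∀ x, ∑ h : e.verts, 𝒢.multMat⁻¹ w x *
      (if gate G e x = h then 𝒢.multDist x h else 0) * 𝒢.Dstar e h z =
      𝒢.multMat⁻¹ w x * 𝒢.multMat x z := by
    intro x
    rw [Finset.sum_eq_single ⟨gate G e x, gate_mem hG e x⟩]
    · rw [if_pos rfl, mul_assoc, multMat, of_apply, 𝒢.multDist_gate hG e x z.2,
        𝒢.multDist_eq_Dstar (gate_mem hG e x) z.2]
    · intro h _ hne
      rw [if_neg, mul_zero, zero_mul]
      intro h'
      exact hne (Subtype.ext h'.symm)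
    · simp
  rw [Finset.sum_congr rfl fun x _ => h2 x, h1, Matrix.one_apply, Matrix.one_apply]
  simp only [Subtype.ext_iff]

/-- The inverse of the multiplicative distance matrix of the block `e`, extended by zero. -/
noncomputable def blockInv (e : Block G) (x y : V) : R :=
  if h : x ∈ e.verts ∧ y ∈ e.verts then (𝒢.Dstar e)⁻¹ ⟨x, h.1⟩ ⟨y, h.2⟩ else 0

theorem blockInv_of_mem {e : Block G} {x y : V} (hx : x ∈ e.verts) (hy : y ∈ e.verts) :
    𝒢.blockInv e x y = (𝒢.Dstar e)⁻¹ ⟨x, hx⟩ ⟨y, hy⟩ := dif_pos ⟨hx, hy⟩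

theorem blockInv_eq_zero_left {e : Block G} {x y : V} (h : x ∉ e.verts) :
    𝒢.blockInv e x y = 0 := dif_neg fun h' => h h'.1

theorem blockInv_eq_zero_right {e : Block G} {x y : V} (h : y ∉ e.verts) :
    𝒢.blockInv e x y = 0 := dif_neg fun h' => h h'.2

/-- The column sums of `blockInv`. -/
noncomputable def blockIn (e : Block G) (y : V) : R := ∑ x ∈ e.verts, 𝒢.blockInv e x y

/-- The row sums of `blockInv`. -/
noncomputable def blockOut (e : Block G) (x : V) : R := ∑ y ∈ e.verts, 𝒢.blockInv e x y

/-- The value of the invariant `det / κ` of the block `e`. -/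
noncomputable def blockAlpha (e : Block G) : R := 𝒢.a e * (1 - ∑ x ∈ e.verts, 𝒢.blockIn e x)

theorem blockIn_eq_zero {e : Block G} {y : V} (h : y ∉ e.verts) : 𝒢.blockIn e y = 0 :=
  Finset.sum_eq_zero fun _ _ => 𝒢.blockInv_eq_zero_right h

theorem blockOut_eq_zero {e : Block G} {x : V} (h : x ∉ e.verts) : 𝒢.blockOut e x = 0 :=
  Finset.sum_eq_zero fun _ _ => 𝒢.blockInv_eq_zero_left h

theorem sum_blockOut (e : Block G) :
    ∑ x ∈ e.verts, 𝒢.blockOut e x = ∑ x ∈ e.verts, 𝒢.blockIn e x := Finset.sum_comm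

variable (hG : G.Connected) (hM : IsUnit 𝒢.multMat.det)

include hG hM

theorem sum_multDist_mul_blockInv {e : Block G} {g : V} (y : V) (hg : g ∈ e.verts) :
    ∑ z ∈ e.verts, 𝒢.multDist g z * 𝒢.blockInv e z y = if g = y then 1 else 0 := by
  by_cases hy : y ∈ e.verts
  · have h := congrFun (congrFun (Matrix.mul_nonsing_inv _ (𝒢.isUnit_det_Dstar hG hM e)) ⟨g, hg⟩)
      ⟨y, hy⟩
    rw [Matrix.mul_apply, Matrix.one_apply] at h
    rw [← Finset.sum_coe_sort]
    simp only [Subtype.mk.injEq] at h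
    rw [← h]
    refine Finset.sum_congr rfl fun z _ => ?_
    rw [𝒢.multDist_eq_Dstar hg z.2, 𝒢.blockInv_of_mem z.2 hy]
  · rw [if_neg (by rintro rfl; exact hy hg)]
    exact Finset.sum_eq_zero fun z _ => by rw [𝒢.blockInv_eq_zero_right hy, mul_zero]

theorem sum_blockInv_mul_multDist {e : Block G} {g : V} (x : V) (hg : g ∈ e.verts) :
    ∑ z ∈ e.verts, 𝒢.blockInv e x z * 𝒢.multDist z g = if x = g then 1 else 0 := by
  by_cases hx : x ∈ e.verts
  · have h := congrFun (congrFun (Matrix.nonsing_inv_mul _ (𝒢.isUnit_det_Dstar hG hM e)) ⟨x, hx⟩)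
      ⟨g, hg⟩
    rw [Matrix.mul_apply, Matrix.one_apply] at h
    rw [← Finset.sum_coe_sort]
    simp only [Subtype.mk.injEq] at h
    rw [← h]
    refine Finset.sum_congr rfl fun z _ => ?_
    rw [𝒢.multDist_eq_Dstar z.2 hg, 𝒢.blockInv_of_mem hx z.2]
  · rw [if_neg (by rintro rfl; exact hx hg)]
    exact Finset.sum_eq_zero fun z _ => by rw [𝒢.blockInv_eq_zero_left hx, zero_mul]

theorem sum_blockIn_mul_multDist {e : Block G} {g : V} (hg : g ∈ e.verts) :
    ∑ x ∈ e.verts, 𝒢.blockIn e x * 𝒢.multDist x g = 1 := by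
  simp only [blockIn, Finset.sum_mul]
  rw [Finset.sum_comm]
  simp only [𝒢.sum_blockInv_mul_multDist hG hM _ hg]
  rw [Finset.sum_ite_eq', if_pos hg]

theorem sum_multDist_mul_blockOut {e : Block G} {g : V} (hg : g ∈ e.verts) :
    ∑ x ∈ e.verts, 𝒢.multDist g x * 𝒢.blockOut e x = 1 := by
  simp only [blockOut, Finset.mul_sum]
  rw [Finset.sum_comm]
  simp only [𝒢.sum_multDist_mul_blockInv hG hM _ hg]
  rw [Finset.sum_ite_eq, if_pos hg]

omit hG hM

/-! ### The inverse of the multiplicative distance matrix -/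

/-- The explicit form of `(D*_G)⁻¹`. -/
noncomputable def multInv : Matrix V V R :=
  of fun x y => (if x = y then 1 else 0) +
    ∑ e : Block G, (𝒢.blockInv e x y - if x = y ∧ y ∈ e.verts then 1 else 0)

theorem sum_mul_multInv (F : V → R) (y : V) :
    ∑ x, F x * 𝒢.multInv x y = F y + ∑ e : Block G,
      (∑ x ∈ e.verts, F x * 𝒢.blockInv e x y - if y ∈ e.verts then F y else 0) := by
  simp only [multInv, of_apply, mul_add, Finset.sum_add_distrib, Finset.mul_sum]
  congr 1
  · simp
  rw [Finset.sum_comm]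
  refine Finset.sum_congr rfl fun e _ => ?_
  simp only [mul_sub, Finset.sum_sub_distrib]
  congr 1
  · refine (Finset.sum_subset (Finset.subset_univ _) fun x _ hx => ?_).symm
    rw [𝒢.blockInv_eq_zero_left hx, mul_zero]
  · simp [ite_and]

theorem sum_multInv_mul (F : V → R) (x : V) :
    ∑ y, 𝒢.multInv x y * F y = F x + ∑ e : Block G,
      (∑ y ∈ e.verts, 𝒢.blockInv e x y * F y - if x ∈ e.verts then F x else 0) := by
  simp only [multInv, of_apply, add_mul, Finset.sum_add_distrib, Finset.sum_mul]
  congr 1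
  · simp
  rw [Finset.sum_comm]
  refine Finset.sum_congr rfl fun e _ => ?_
  simp only [sub_mul, Finset.sum_sub_distrib]
  congr 1
  · refine (Finset.sum_subset (Finset.subset_univ _) fun y _ hy => ?_).symm
    rw [𝒢.blockInv_eq_zero_right hy, zero_mul]
  · simp [ite_and]

include hG hM

/-- The summand of a block through `y` is 0 if the gate of `x` is `y` and -m_{xy} otherwise. The
latter happens once for `x ≠ y`, cancelling the identity term. -/
theorem multMat_mul_multInv : 𝒢.multMat * 𝒢.multInv = 1 := by
  ext x y
  rw [Matrix.mul_apply, 𝒢.sum_mul_multInv (𝒢.multMat x)]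
  have h : ∀ e : Block G, (∑ z ∈ e.verts, 𝒢.multMat x z * 𝒢.blockInv e z y -
      if y ∈ e.verts then 𝒢.multMat x y else 0) =
      -(if y ∈ e.verts ∧ gate G e x ≠ y then 𝒢.multMat x y else 0) := by
    intro e
    have : ∑ z ∈ e.verts, 𝒢.multMat x z * 𝒢.blockInv e z y =
        𝒢.multDist x (gate G e x) * if gate G e x = y then 1 else 0 := by
      rw [← 𝒢.sum_multDist_mul_blockInv hG hM y (gate_mem hG e x), Finset.mul_sum]
      refine Finset.sum_congr rfl fun z hz => ?_
      rw [multMat, of_apply, 𝒢.multDist_gate hG e x hz, mul_assoc]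
    rw [this]
    by_cases hg : gate G e x = y
    · have hy : y ∈ e.verts := hg ▸ gate_mem hG e x
      simp [hg, hy, multMat]
    · simp [hg]
  rw [Finset.sum_congr rfl fun e _ => h e, Finset.sum_neg_distrib, sum_ite_gate_ne hG,
    Matrix.one_apply]
  split_ifs with hxy
  · subst hxy
    simp [multMat, 𝒢.multDist_self]
  · simp

theorem inv_multMat : 𝒢.multMat⁻¹ = 𝒢.multInv :=
  Matrix.inv_eq_right_inv (𝒢.multMat_mul_multInv hG hM)

theorem tauIn_eq (y : V) : 𝒢.tauIn y = 1 + ∑ e : Block G,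
    (𝒢.blockIn e y - if y ∈ e.verts then 1 else 0) := by
  have h := 𝒢.sum_mul_multInv (fun _ => 1) y
  simp only [one_mul] at h
  simp only [tauIn, Matrix.vecMul, dotProduct, 𝒢.inv_multMat hG hM, one_mul, h]
  rfl

theorem tauOut_eq (x : V) : 𝒢.tauOut x = 1 + ∑ e : Block G,
    (𝒢.blockOut e x - if x ∈ e.verts then 1 else 0) := by
  have h := 𝒢.sum_multInv_mul (fun _ => 1) x
  simp only [mul_one] at h
  simp only [tauOut, Matrix.mulVec, dotProduct, 𝒢.inv_multMat hG hM, mul_one, h]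
  rfl

theorem sum_tauIn_mul_multMat (y : V) : ∑ x, 𝒢.tauIn x * 𝒢.multMat x y = 1 := by
  have h : 𝒢.tauIn ᵥ* 𝒢.multMat = fun _ => 1 := by
    rw [tauIn, Matrix.vecMul_vecMul, Matrix.nonsing_inv_mul _ hM, Matrix.vecMul_one]
  exact congrFun h y

theorem sum_tauIn_mul (F : V → R) : ∑ x, 𝒢.tauIn x * F x =
    ∑ x, F x + ∑ e : Block G, (∑ x ∈ e.verts, 𝒢.blockIn e x * F x - ∑ x ∈ e.verts, F x) := by
  simp only [𝒢.tauIn_eq hG hM, add_mul, one_mul, Finset.sum_add_distrib, Finset.sum_mul]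
  rw [Finset.sum_comm]
  congr 1
  refine Finset.sum_congr rfl fun e _ => ?_
  simp only [sub_mul, Finset.sum_sub_distrib, ite_mul, one_mul, zero_mul]
  congr 1
  · refine (Finset.sum_subset (Finset.subset_univ _) fun y _ hy => ?_).symm
    rw [𝒢.blockIn_eq_zero hy, zero_mul]
  · simp

theorem sum_mul_tauOut (F : V → R) : ∑ x, F x * 𝒢.tauOut x =
    ∑ x, F x + ∑ e : Block G, (∑ x ∈ e.verts, F x * 𝒢.blockOut e x - ∑ x ∈ e.verts, F x) := by
  simp only [𝒢.tauOut_eq hG hM, mul_add, mul_one, Finset.sum_add_distrib, Finset.mul_sum]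
  rw [Finset.sum_comm]
  congr 1
  refine Finset.sum_congr rfl fun e _ => ?_
  simp only [mul_sub, Finset.sum_sub_distrib, mul_ite, mul_one, mul_zero]
  congr 1
  · refine (Finset.sum_subset (Finset.subset_univ _) fun y _ hy => ?_).symm
    rw [𝒢.blockOut_eq_zero hy, mul_zero]
  · simp

/-! ### Determinants -/

/-- Grouping the plain column sum by blocks as seen from `y` cancels all sums over blocks not
weighted by `blockIn`. What remains in `e` is the weighted sum minus the entry at the gate, which is
α_e. -/
theorem sum_tauIn_mul_distMat (y : V) :
    ∑ x, 𝒢.tauIn x * 𝒢.distMat x y = ∑ e : Block G, 𝒢.blockAlpha e := by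
  rw [𝒢.sum_tauIn_mul hG hM (fun x => 𝒢.distMat x y), sum_eq_sum_block hG y]
  simp only [distMat, of_apply, 𝒢.addMultDist_self, zero_add]
  rw [← Finset.sum_add_distrib]
  refine Finset.sum_congr rfl fun e _ => ?_
  have h : ∑ x ∈ e.verts, 𝒢.blockIn e x * 𝒢.addMultDist x y =
      𝒢.blockAlpha e + 𝒢.addMultDist (gate G e y) y := by
    have h1 : ∀ x ∈ e.verts, 𝒢.blockIn e x * 𝒢.addMultDist x y =
        (𝒢.a e + 𝒢.addMultDist (gate G e y) y) *
          (𝒢.blockIn e x * 𝒢.multDist x (gate G e y)) - 𝒢.a e * 𝒢.blockIn e x := by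
      intro x hx
      rw [𝒢.addMultDist_gate' hG e y hx]
      ring
    rw [Finset.sum_congr rfl h1, Finset.sum_sub_distrib, ← Finset.mul_sum, ← Finset.mul_sum,
      𝒢.sum_blockIn_mul_multDist hG hM (gate_mem hG e y), blockAlpha]
    ring
  rw [h]
  ring

theorem kappaAt_distMat (v₀ : V) : kappaAt 𝒢.distMat 𝒢.multMat v₀ = 𝒢.kap :=
  kappaAt_eq_kappa v₀ (𝒢.sum_tauIn_mul_distMat hG hM) (𝒢.sum_tauIn_mul_multMat hG hM)
    𝒢.multDist_self 𝒢.addMultDist_self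

theorem det_distMat : 𝒢.distMat.det = (∑ e : Block G, 𝒢.blockAlpha e) * 𝒢.kap := by
  obtain ⟨v₀⟩ := hG.nonempty
  rw [← 𝒢.kappaAt_distMat hG hM v₀]
  exact det_eq_mul_kappaAt v₀ (𝒢.sum_tauIn_mul_distMat hG hM) (𝒢.sum_tauIn_mul_multMat hG hM)
    𝒢.multDist_self 𝒢.addMultDist_self

/-! ### Gate matrices and the invertibility of κ -/

omit hG hM

/-- The matrix with entries `∑_e c_e ([x = g_e(y)] - [x = g_e(v₀)])`. -/
noncomputable def _root_.AddMulGraph.gateMat (G : SimpleGraph V) (c : Block G → R) (v₀ : V) :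
    Matrix V V R :=
  of fun x y => ∑ e : Block G,
    c e * ((if x = gate G e y then 1 else 0) - if x = gate G e v₀ then 1 else 0)

theorem _root_.AddMulGraph.sum_mul_gateMat (c : Block G → R) (v₀ y : V) (F : V → R) :
    ∑ x, F x * gateMat G c v₀ x y =
      ∑ e : Block G, c e * (F (gate G e y) - F (gate G e v₀)) := by
  simp only [gateMat, of_apply, Finset.mul_sum]
  rw [Finset.sum_comm]
  refine Finset.sum_congr rfl fun e _ => ?_
  rw [Finset.sum_congr rfl fun x _ => mul_left_comm (F x) (c e) _, ← Finset.mul_sum]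
  simp [mul_sub, Finset.sum_sub_distrib]

include hG

theorem _root_.AddMulGraph.sum_gate_eq (v₀ x y : V) :
    ∑ e : Block G, ((if x = gate G e y then (1 : R) else 0) -
      if x = gate G e v₀ then 1 else 0) =
      (if x = y then 1 else 0) - if x = v₀ then 1 else 0 := by
  have h1 : ∀ (u : V) (e : Block G), (if x = gate G e u then (1 : R) else 0) =
      (if x ∈ e.verts then 1 else 0) - if x ∈ e.verts ∧ gate G e u ≠ x then 1 else 0 := by
    intro u e
    by_cases hg : x = gate G e u
    · have hx : x ∈ e.verts := hg ▸ gate_mem hG e u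
      simp [← hg, hx]
    · simp [hg, Ne.symm hg]
  simp only [h1, sub_sub_sub_cancel_left, Finset.sum_sub_distrib, sum_ite_gate_ne hG]
  simp only [eq_comm (a := x)]
  by_cases h : y = x <;> by_cases h' : v₀ = x <;> simp [h, h']

/-- Terms from two different blocks vanish because the gate into one is constant on the other. The
diagonal terms telescope by `sum_gate_eq`. -/
theorem _root_.AddMulGraph.gateMat_mul_gateMat {c c' : Block G → R}
    (h : ∀ e, c e * c' e = 1) (v₀ x y : V) :
    ∑ z, gateMat G c v₀ x z * gateMat G c' v₀ z y =
      (if x = y then 1 else 0) - if x = v₀ then 1 else 0 := by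
  rw [sum_mul_gateMat]
  simp only [gateMat, of_apply]
  rw [← sum_gate_eq hG v₀ x y]
  refine Finset.sum_congr rfl fun f _ => ?_
  rw [← Finset.sum_sub_distrib, Finset.sum_eq_single f]
  · rw [gate_of_mem hG (gate_mem hG f y), gate_of_mem hG (gate_mem hG f v₀)]
    linear_combination ((if x = gate G f y then (1 : R) else 0) -
      if x = gate G f v₀ then 1 else 0) * h f
  · intro e _ hef
    rw [gate_gate_of_ne hG (Ne.symm hef) y v₀]
    ring
  · simp

theorem _root_.AddMulGraph.isUnit_det_gateMat {c : Block G → R}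
    (h : ∀ e, IsUnit (c e)) (v₀ : V) :
    IsUnit (of fun x y : {x : V // x ≠ v₀} => gateMat G c v₀ x y).det := by
  refine Matrix.isUnit_det_of_right_inverse
    (B := of fun x y => gateMat G (fun e => Ring.inverse (c e)) v₀ (x : V) y) ?_
  ext x y
  have h1 := gateMat_mul_gateMat hG (c := c) (c' := fun e => Ring.inverse (c e))
    (fun e => Ring.mul_inverse_cancel _ (h e)) v₀ x y
  rw [sum_eq_sum_ne_add _ v₀, if_neg x.2, sub_zero] at h1
  have h2 : gateMat G c v₀ x v₀ = 0 := by simp [gateMat]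
  rw [h2, zero_mul, add_zero] at h1
  rw [Matrix.mul_apply, Matrix.one_apply]
  simp only [of_apply, h1, Subtype.ext_iff]

include hM

/-- In (D*)⁻¹ D the column index enters only through its gates; the `blockOut` terms drop out of
column differences. -/
theorem distMat_sub_distMat (v₀ x y : V) : 𝒢.distMat x y - 𝒢.distMat x v₀ =
    ∑ z, 𝒢.multMat x z * gateMat G 𝒢.a v₀ z y := by
  have h1 : ∀ z u, (𝒢.multInv * 𝒢.distMat) z u = ∑ e : Block G,
      𝒢.a e * ((if z = gate G e u then 1 else 0) - 𝒢.blockOut e z) := by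
    intro z u
    rw [Matrix.mul_apply, 𝒢.sum_multInv_mul (fun y => 𝒢.distMat y u)]
    have h2 : ∀ e : Block G, (∑ y ∈ e.verts, 𝒢.blockInv e z y * 𝒢.distMat y u -
        if z ∈ e.verts then 𝒢.distMat z u else 0) =
        𝒢.a e * ((if z = gate G e u then 1 else 0) - 𝒢.blockOut e z) -
          if z ∈ e.verts ∧ gate G e u ≠ z then 𝒢.distMat z u else 0 := by
      intro e
      have h3 : ∀ y ∈ e.verts, 𝒢.blockInv e z y * 𝒢.distMat y u =
          (𝒢.a e + 𝒢.addMultDist (gate G e u) u) *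
            (𝒢.blockInv e z y * 𝒢.multDist y (gate G e u)) - 𝒢.a e * 𝒢.blockInv e z y := by
        intro y hy
        rw [distMat, of_apply, 𝒢.addMultDist_gate' hG e u hy]
        ring
      rw [Finset.sum_congr rfl h3, Finset.sum_sub_distrib, ← Finset.mul_sum, ← Finset.mul_sum,
        𝒢.sum_blockInv_mul_multDist hG hM z (gate_mem hG e u)]
      by_cases hg : z = gate G e u
      · have hz : z ∈ e.verts := hg ▸ gate_mem hG e u
        simp only [← hg, hz, if_true, distMat, of_apply, blockOut]
        simp
        ring
      · simp only [hg, Ne.symm hg, if_false, blockOut, ne_eq, not_false_eq_true, and_true]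
        ring
    rw [Finset.sum_congr rfl fun e _ => h2 e, Finset.sum_sub_distrib, sum_ite_gate_ne hG]
    split_ifs with hzu
    · subst hzu
      simp [distMat, 𝒢.addMultDist_self]
    · ring
  have h2 : 𝒢.distMat = 𝒢.multMat * (𝒢.multInv * 𝒢.distMat) := by
    rw [← Matrix.mul_assoc, 𝒢.multMat_mul_multInv hG hM, Matrix.one_mul]
  have h3 : ∀ z, gateMat G 𝒢.a v₀ z y =
      (𝒢.multInv * 𝒢.distMat) z y - (𝒢.multInv * 𝒢.distMat) z v₀ := by
    intro z
    rw [h1, h1, ← Finset.sum_sub_distrib]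
    simp only [gateMat, of_apply]
    refine Finset.sum_congr rfl fun e _ => ?_
    ring
  simp only [h3, mul_sub, Finset.sum_sub_distrib]
  rw [← Matrix.mul_apply, ← Matrix.mul_apply, ← h2]

theorem isUnit_kap (ha : ∀ e, IsUnit (𝒢.a e)) : IsUnit 𝒢.kap := by
  obtain ⟨v₀⟩ := hG.nonempty
  rw [← 𝒢.kappaAt_distMat hG hM v₀, kappaAt_eq_det_mul_det (D := 𝒢.distMat) (M := 𝒢.multMat) v₀
    (𝒢.multDist_self v₀) (𝒢.addMultDist_self v₀) (𝒢.distMat_sub_distMat hG hM v₀)]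
  exact hM.mul (isUnit_det_gateMat hG ha v₀)

theorem alpha_eq (ha : ∀ e, IsUnit (𝒢.a e)) : 𝒢.alpha = ∑ e : Block G, 𝒢.blockAlpha e := by
  rw [alpha, 𝒢.det_distMat hG hM, mul_assoc,
    Ring.mul_inverse_cancel _ (𝒢.isUnit_kap hG hM ha), mul_one]

end BlockDatum

namespace BlockDatum

variable {V : Type*} [Fintype V] [DecidableEq V] {G : SimpleGraph V} {R : Type*} [CommRing R]
  (𝒢 : BlockDatum G R) (hG : G.Connected) (hM : IsUnit 𝒢.multMat.det)

include hG hM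

/-! ### The determinants of the blocks -/

theorem sum_blockIn_mul_Dstar (e : Block G) (y : e.verts) :
    ∑ x : e.verts, 𝒢.blockIn e x * 𝒢.Dstar e x y = 1 := by
  rw [← 𝒢.sum_blockIn_mul_multDist hG hM y.2,
    ← Finset.sum_coe_sort e.verts (fun x => 𝒢.blockIn e x * 𝒢.multDist x y)]
  exact Finset.sum_congr rfl fun x _ => by rw [𝒢.multDist_eq_Dstar x.2 y.2]

theorem sum_blockIn_mul_blockMat (e : Block G) (y : e.verts) :
    ∑ x : e.verts, 𝒢.blockIn e x * 𝒢.blockMat e x y = 𝒢.blockAlpha e := by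
  have h : ∀ x : e.verts, 𝒢.blockIn e x * 𝒢.blockMat e x y =
      𝒢.a e * (𝒢.blockIn e x * 𝒢.Dstar e x y - 𝒢.blockIn e x) := by
    intro x
    rw [blockMat, of_apply]
    ring
  rw [Finset.sum_congr rfl fun x _ => h x, ← Finset.mul_sum, Finset.sum_sub_distrib,
    𝒢.sum_blockIn_mul_Dstar hG hM, blockAlpha, ← Finset.sum_coe_sort e.verts]

omit hG hM in
theorem blockMat_self (e : Block G) (x : e.verts) : 𝒢.blockMat e x x = 0 := by
  simp [blockMat, 𝒢.diag]

theorem kappaAt_blockMat (e : Block G) (v₀ : e.verts) :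
    kappaAt (𝒢.blockMat e) (𝒢.Dstar e) v₀ = 𝒢.blockKap e :=
  kappaAt_eq_kappa v₀ (𝒢.sum_blockIn_mul_blockMat hG hM e) (𝒢.sum_blockIn_mul_Dstar hG hM e)
    (𝒢.diag e) (𝒢.blockMat_self e)

/-- Column differences of D_e are a_e times those of D*_e, so κ is det D*_e times a power of a_e. -/
theorem isUnit_blockKap (ha : ∀ e, IsUnit (𝒢.a e)) (e : Block G) : IsUnit (𝒢.blockKap e) := by
  obtain ⟨v, hv⟩ := e.nonempty
  set v₀ : e.verts := ⟨v, hv⟩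
  rw [← 𝒢.kappaAt_blockMat hG hM e v₀, kappaAt_eq_det_mul_det
    (H := of fun x y => 𝒢.a e * ((if x = y then 1 else 0) - if x = v₀ then 1 else 0)) v₀
    (𝒢.diag e v₀) (𝒢.blockMat_self e v₀)]
  · refine (𝒢.isUnit_det_Dstar hG hM e).mul ?_
    have h : (of fun x y : {x : e.verts // x ≠ v₀} => (of fun x y : e.verts =>
        𝒢.a e * ((if x = y then 1 else 0) - if x = v₀ then 1 else 0)) (x : e.verts) y) =
        𝒢.a e • (1 : Matrix {x : e.verts // x ≠ v₀} {x : e.verts // x ≠ v₀} R) := by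
      ext x y
      simp only [of_apply, if_neg x.2, Matrix.smul_apply, Matrix.one_apply, smul_eq_mul, sub_zero,
        ← Subtype.ext_iff]
    rw [h, Matrix.det_smul, Matrix.det_one, mul_one]
    exact (ha e).pow _
  · intro x y
    have h : ∀ z, 𝒢.Dstar e x z * (of fun x y : e.verts =>
        𝒢.a e * ((if x = y then 1 else 0) - if x = v₀ then 1 else 0)) z y =
        𝒢.a e * ((if z = y then 𝒢.Dstar e x z else 0) -
          if z = v₀ then 𝒢.Dstar e x z else 0) := by
      intro z
      simp only [of_apply]
      split_ifs <;> ring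
    rw [Finset.sum_congr rfl fun z _ => h z, ← Finset.mul_sum, Finset.sum_sub_distrib]
    simp only [Finset.sum_ite_eq', Finset.mem_univ, if_true, blockMat, of_apply]
    ring

theorem det_blockMat (e : Block G) :
    (𝒢.blockMat e).det = 𝒢.blockAlpha e * 𝒢.blockKap e := by
  obtain ⟨v, hv⟩ := e.nonempty
  rw [← 𝒢.kappaAt_blockMat hG hM e ⟨v, hv⟩]
  exact det_eq_mul_kappaAt _ (𝒢.sum_blockIn_mul_blockMat hG hM e)
    (𝒢.sum_blockIn_mul_Dstar hG hM e) (𝒢.diag e) (𝒢.blockMat_self e)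

/-! ### The Laplacian -/

theorem lapOff_eq {i j : V} (hij : i ≠ j) :
    𝒢.lapOff i j = ∑ e : Block G, -(Ring.inverse (𝒢.a e) * 𝒢.blockInv e i j) := by
  rw [lapOff, Finset.sum_filter]
  refine Finset.sum_congr rfl fun e _ => ?_
  split_ifs with h
  · rw [𝒢.inv_multMat hG hM, multInv, of_apply, if_neg hij, zero_add, Finset.sum_eq_single e]
    · simp [hij]
    · intro f _ hfe
      rw [if_neg (fun h' => hij h'.1), sub_zero]
      exact dif_neg fun h' => hfe (Block.eq_of_two_mem hij h'.1 h'.2 h.1 h.2)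
    · simp
  · rw [blockInv, dif_neg h, mul_zero, neg_zero]

theorem lapMat_eq (i j : V) : 𝒢.lapMat i j = ∑ e : Block G,
    -(Ring.inverse (𝒢.a e) * (𝒢.blockInv e i j - if i = j then 𝒢.blockIn e j else 0)) := by
  rw [lapMat, of_apply]
  split_ifs with hij
  · subst hij
    rw [Finset.sum_congr rfl fun k hk => 𝒢.lapOff_eq hG hM (Finset.ne_of_mem_erase hk),
      Finset.sum_comm, ← Finset.sum_neg_distrib]
    refine Finset.sum_congr rfl fun e _ => ?_
    have h : 𝒢.blockIn e i = ∑ k, 𝒢.blockInv e k i :=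
      Finset.sum_subset (Finset.subset_univ _) fun k _ hk => 𝒢.blockInv_eq_zero_left hk
    rw [Finset.sum_neg_distrib, ← Finset.mul_sum, h, ← Finset.add_sum_erase _ _ (Finset.mem_univ i)]
    ring
  · simp only [sub_zero]
    exact 𝒢.lapOff_eq hG hM hij

/-- In each block a row of D is a_e times the corresponding row of D* plus a constant. The constant
is killed because the columns of L sum to zero blockwise, and the factor a_e cancels the weight
1/a_e. -/
theorem distMat_mul_lapMat (ha : ∀ e, IsUnit (𝒢.a e)) :
    𝒢.distMat * 𝒢.lapMat = 𝒢.multMat * diagonal 𝒢.tauIn - 1 := by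
  ext x y
  rw [Matrix.mul_apply, Matrix.sub_apply, Matrix.mul_diagonal, 𝒢.tauIn_eq hG hM,
    Matrix.one_apply]
  simp only [𝒢.lapMat_eq hG hM, Finset.mul_sum]
  rw [Finset.sum_comm]
  have h : ∀ e : Block G, ∑ z, 𝒢.distMat x z * -(Ring.inverse (𝒢.a e) *
      (𝒢.blockInv e z y - if z = y then 𝒢.blockIn e y else 0)) =
      𝒢.multMat x y * (𝒢.blockIn e y - if y ∈ e.verts then 1 else 0) +
        if y ∈ e.verts ∧ gate G e x ≠ y then 𝒢.multMat x y else 0 := by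
    intro e
    have h1 : ∀ z, 𝒢.distMat x z * -(Ring.inverse (𝒢.a e) *
        (𝒢.blockInv e z y - if z = y then 𝒢.blockIn e y else 0)) =
        -Ring.inverse (𝒢.a e) * (𝒢.distMat x z * 𝒢.blockInv e z y -
          if z = y then 𝒢.distMat x z * 𝒢.blockIn e y else 0) := by
      intro z
      split_ifs <;> ring
    have h2 : ∑ z, 𝒢.distMat x z * 𝒢.blockInv e z y =
        ∑ z ∈ e.verts, 𝒢.distMat x z * 𝒢.blockInv e z y :=
      (Finset.sum_subset (Finset.subset_univ _) fun z _ hz => by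
        rw [𝒢.blockInv_eq_zero_left hz, mul_zero]).symm
    rw [Finset.sum_congr rfl fun z _ => h1 z, ← Finset.mul_sum, Finset.sum_sub_distrib, h2,
      Finset.sum_ite_eq', if_pos (Finset.mem_univ y)]
    by_cases hy : y ∈ e.verts
    · have h3 : ∀ z ∈ e.verts, 𝒢.distMat x z * 𝒢.blockInv e z y =
          (𝒢.addMultDist x (gate G e x) - 𝒢.multDist x (gate G e x) * 𝒢.a e) *
            𝒢.blockInv e z y + 𝒢.multDist x (gate G e x) * 𝒢.a e *
              (𝒢.multDist (gate G e x) z * 𝒢.blockInv e z y) := by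
        intro z hz
        rw [distMat, of_apply, 𝒢.addMultDist_gate hG e x hz]
        ring
      rw [Finset.sum_congr rfl h3, Finset.sum_add_distrib, ← Finset.mul_sum, ← Finset.mul_sum,
        𝒢.sum_multDist_mul_blockInv hG hM y (gate_mem hG e x), distMat, multMat, of_apply,
        of_apply, 𝒢.addMultDist_gate hG e x hy, 𝒢.multDist_gate hG e x hy, if_pos hy, ← blockIn]
      have ha' := Ring.mul_inverse_cancel _ (ha e)
      by_cases hg : gate G e x = y
      · simp only [hg, 𝒢.multDist_self, ne_eq, not_true, and_false, if_true, if_false]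
        linear_combination (𝒢.multDist x y * 𝒢.blockIn e y - 𝒢.multDist x y) * ha'
      · simp only [hg, hy, ne_eq, not_false_eq_true, and_self, if_true, if_false]
        linear_combination (𝒢.multDist x (gate G e x) * 𝒢.multDist (gate G e x) y *
          𝒢.blockIn e y) * ha'
    · rw [Finset.sum_eq_zero fun z _ => by rw [𝒢.blockInv_eq_zero_right hy, mul_zero],
        𝒢.blockIn_eq_zero hy]
      simp [hy]
  rw [Finset.sum_congr rfl fun e _ => h e, Finset.sum_add_distrib, ← Finset.mul_sum,
    sum_ite_gate_ne hG]
  split_ifs with hxy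
  · subst hxy
    simp only [multMat, of_apply, 𝒢.multDist_self]
    ring
  · ring

/-! ### The inverse of the additive-multiplicative distance matrix -/

theorem sum_distMat_mul_tauOut (ha : ∀ e, IsUnit (𝒢.a e)) (x : V) :
    ∑ z, 𝒢.distMat x z * 𝒢.tauOut z = ∑ e : Block G, 𝒢.blockAlpha e *
      (𝒢.multMat x (gate G e x) - 𝒢.distMat x (gate G e x) * Ring.inverse (𝒢.a e)) := by
  rw [𝒢.sum_mul_tauOut hG hM (𝒢.distMat x), sum_eq_sum_block hG x]
  simp only [distMat, multMat, of_apply, 𝒢.addMultDist_self, zero_add]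
  rw [← Finset.sum_add_distrib]
  refine Finset.sum_congr rfl fun e _ => ?_
  have h1 : ∀ z ∈ e.verts, 𝒢.addMultDist x z * 𝒢.blockOut e z =
      (𝒢.addMultDist x (gate G e x) - 𝒢.multDist x (gate G e x) * 𝒢.a e) * 𝒢.blockOut e z +
        𝒢.multDist x (gate G e x) * 𝒢.a e *
          (𝒢.multDist (gate G e x) z * 𝒢.blockOut e z) := by
    intro z hz
    rw [𝒢.addMultDist_gate hG e x hz]
    ring
  rw [Finset.sum_congr rfl h1, Finset.sum_add_distrib, ← Finset.mul_sum, ← Finset.mul_sum,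
    𝒢.sum_multDist_mul_blockOut hG hM (gate_mem hG e x), 𝒢.sum_blockOut, blockAlpha]
  linear_combination (𝒢.addMultDist x (gate G e x) * (1 - ∑ z ∈ e.verts, 𝒢.blockIn e z)) *
    Ring.mul_inverse_cancel _ (ha e)

/-! ### The matrix C and the directions from a vertex -/

omit hG hM

/-- The sum of `1 / a_e` over the blocks `e ∋ i` with `f ⊆ G_{i → e}` (there is only one). -/
noncomputable def towardBlock (i : V) (f : Block G) : R :=
  ∑ e : Block G with i ∈ e.verts ∧ (f.verts : Set V) ⊆ branch G i e, Ring.inverse (𝒢.a e)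

/-- The sum of `1 / a_e` over the blocks `e ∋ i` with `j ∈ G_{i → e}` (only one if `j ≠ i`). -/
noncomputable def towardVertex (i j : V) : R :=
  ∑ e : Block G with i ∈ e.verts ∧ j ∈ branch G i e, Ring.inverse (𝒢.a e)

/-- The matrix of `towardVertex`, with diagonal entries replaced by zero. -/
noncomputable def towardMat : Matrix V V R :=
  of fun i j => if i = j then 0 else 𝒢.towardVertex i j

include hG

theorem towardBlock_eq_towardVertex {i j : V} {f : Block G} (hj : j ∈ f.verts) (hji : j ≠ i) :
    𝒢.towardBlock i f = 𝒢.towardVertex i j := by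
  refine Finset.sum_congr (Finset.filter_congr fun e _ => ?_) fun _ _ => rfl
  exact and_congr_right fun hi => subset_branch_iff_mem hG hi hj hji

theorem towardBlock_of_mem {i : V} {f : Block G} (hi : i ∈ f.verts) :
    𝒢.towardBlock i f = Ring.inverse (𝒢.a f) := by
  have h : (Finset.univ.filter fun e : Block G =>
      i ∈ e.verts ∧ (f.verts : Set V) ⊆ branch G i e) = {f} := by
    ext e
    simp only [Finset.mem_filter, Finset.mem_univ, true_and, Finset.mem_singleton]
    refine ⟨fun h => (subset_branch_iff_eq hG h.1 hi).1 h.2, ?_⟩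
    rintro rfl
    exact ⟨hi, (subset_branch_iff_eq hG hi hi).2 rfl⟩
  rw [towardBlock, h, Finset.sum_singleton]

theorem sum_distMat_mul_towardBlock (x : V) {j : V} {f : Block G} (hj : j ∈ f.verts) :
    ∑ i, 𝒢.distMat x i * 𝒢.towardBlock i f =
      (𝒢.distMat * 𝒢.towardMat) x j + 𝒢.distMat x j * Ring.inverse (𝒢.a f) := by
  have h : ∀ i, 𝒢.distMat x i * 𝒢.towardBlock i f = 𝒢.distMat x i * 𝒢.towardMat i j +
      if i = j then 𝒢.distMat x i * Ring.inverse (𝒢.a f) else 0 := by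
    intro i
    rw [towardMat, of_apply]
    split_ifs with hij
    · rw [hij, 𝒢.towardBlock_of_mem hG hj, mul_zero, zero_add]
    · rw [𝒢.towardBlock_eq_towardVertex hG hj (Ne.symm hij), add_zero]
  rw [Finset.sum_congr rfl fun i _ => h i, Finset.sum_add_distrib, Matrix.mul_apply]
  simp

theorem distMat_mul_towardMat_add (ha : ∀ e, IsUnit (𝒢.a e)) (x : V) {j : V} {f : Block G}
    (hj : j ∈ f.verts) :
    (𝒢.distMat * 𝒢.towardMat) x j + 𝒢.multMat x j =
      ∑ i, 𝒢.distMat x i * 𝒢.towardBlock i f + 𝒢.multMat x (gate G f x) -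
        𝒢.distMat x (gate G f x) * Ring.inverse (𝒢.a f) := by
  rw [𝒢.sum_distMat_mul_towardBlock hG x hj]
  simp only [distMat, multMat, of_apply]
  rw [𝒢.addMultDist_gate hG f x hj, 𝒢.multDist_gate hG f x hj]
  linear_combination (-𝒢.multDist x (gate G f x) * (𝒢.multDist (gate G f x) j - 1)) *
    Ring.mul_inverse_cancel _ (ha f)

/-- Within a block `f` the expression in `distMat_mul_towardMat_add` does not depend on the vertex
of `f`; adjacent vertices share a block, so a walk carries the value from `j` to `k`. -/
theorem distMat_mul_towardMat_add_const (ha : ∀ e, IsUnit (𝒢.a e)) (x j k : V) :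
    (𝒢.distMat * 𝒢.towardMat) x j + 𝒢.multMat x j =
      (𝒢.distMat * 𝒢.towardMat) x k + 𝒢.multMat x k := by
  obtain ⟨p⟩ := hG.preconnected j k
  induction p with
  | nil => rfl
  | cons hadj _ ih =>
    obtain ⟨f, h1, h2⟩ := exists_block_of_adj hadj
    rw [← ih, 𝒢.distMat_mul_towardMat_add hG ha x h1, 𝒢.distMat_mul_towardMat_add hG ha x h2]

include hM

theorem isUnit_alpha (hD : IsUnit 𝒢.distMat.det) (ha : ∀ e, IsUnit (𝒢.a e)) :
    IsUnit 𝒢.alpha :=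
  hD.mul (isUnit_ringInverse.2 (𝒢.isUnit_kap hG hM ha))

theorem beta_eq (hD : IsUnit 𝒢.distMat.det) (ha : ∀ e, IsUnit (𝒢.a e)) (i : V) :
    𝒢.beta i = Ring.inverse 𝒢.alpha *
      ∑ e : Block G with i ∈ e.verts, Ring.inverse (𝒢.a e) *
        ∑ f : Block G with (f.verts : Set V) ⊆ branch G i e, 𝒢.blockAlpha f := by
  have h1 : 𝒢.kap * Ring.inverse 𝒢.distMat.det = Ring.inverse 𝒢.alpha := by
    have hk := 𝒢.isUnit_kap hG hM ha
    have h2 := Ring.mul_inverse_cancel _ hD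
    have h3 := Ring.mul_inverse_cancel _ hk
    have h4 := Ring.inverse_mul_cancel _ (𝒢.isUnit_alpha hG hM hD ha)
    have h5 : 𝒢.alpha * (𝒢.kap * Ring.inverse 𝒢.distMat.det) = 1 := by
      rw [alpha]
      linear_combination h2 + 𝒢.distMat.det * Ring.inverse 𝒢.distMat.det * h3
    linear_combination Ring.inverse 𝒢.alpha * h5 -
      𝒢.kap * Ring.inverse 𝒢.distMat.det * h4
  rw [beta, h1]
  congr 1
  refine Finset.sum_congr rfl fun e _ => ?_
  congr 1
  refine Finset.sum_congr rfl fun f _ => ?_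
  rw [𝒢.det_blockMat hG hM, mul_assoc, Ring.mul_inverse_cancel _ (𝒢.isUnit_blockKap hG hM ha f),
    mul_one]

theorem alpha_mul_beta (hD : IsUnit 𝒢.distMat.det) (ha : ∀ e, IsUnit (𝒢.a e)) (i : V) :
    𝒢.alpha * 𝒢.beta i = ∑ f : Block G, 𝒢.blockAlpha f * 𝒢.towardBlock i f := by
  rw [𝒢.beta_eq hG hM hD ha, ← mul_assoc,
    Ring.mul_inverse_cancel _ (𝒢.isUnit_alpha hG hM hD ha), one_mul]
  simp only [towardBlock, Finset.mul_sum, Finset.sum_filter, mul_ite, mul_zero, ite_and]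
  rw [Finset.sum_comm]
  refine Finset.sum_congr rfl fun e _ => ?_
  split_ifs
  · simp only [mul_comm]
  · simp

theorem alpha_mul_cMat (hD : IsUnit 𝒢.distMat.det) (ha : ∀ e, IsUnit (𝒢.a e)) (i j : V) :
    𝒢.alpha * 𝒢.cMat i j = ∑ f : Block G, 𝒢.blockAlpha f * 𝒢.towardBlock i f -
      𝒢.alpha * 𝒢.towardMat i j := by
  rw [← 𝒢.alpha_mul_beta hG hM hD ha, cMat, of_apply, towardMat, of_apply]
  split_ifs
  · ring
  · rw [towardVertex]
    ring

/-- After multiplication by α, the matrix C becomes the α_f-weighted sum of `towardBlock` minus α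
times `towardMat`. Applying D, the gate terms of each block cancel those of D τ_out
(`sum_distMat_mul_tauOut`), the `towardMat` terms cancel, and α D* is left. -/
theorem distMat_mul_eq_multMat (hD : IsUnit 𝒢.distMat.det) (ha : ∀ e, IsUnit (𝒢.a e)) :
    𝒢.distMat * (Ring.inverse 𝒢.alpha • vecMulVec 𝒢.tauOut (fun _ => 1) + 𝒢.cMat) =
      𝒢.multMat := by
  have hα := 𝒢.isUnit_alpha hG hM hD ha
  ext x j
  apply hα.mul_left_cancel
  have h1 : ∀ i, 𝒢.alpha * (𝒢.distMat x i *
      (Ring.inverse 𝒢.alpha * 𝒢.tauOut i + 𝒢.cMat i j)) =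
      𝒢.distMat x i * 𝒢.tauOut i +
      (∑ f : Block G, 𝒢.blockAlpha f * (𝒢.distMat x i * 𝒢.towardBlock i f) -
        𝒢.alpha * (𝒢.distMat x i * 𝒢.towardMat i j)) := by
    intro i
    have h2 := 𝒢.alpha_mul_cMat hG hM hD ha i j
    have h3 : ∑ f : Block G, 𝒢.blockAlpha f * (𝒢.distMat x i * 𝒢.towardBlock i f) =
        𝒢.distMat x i * ∑ f : Block G, 𝒢.blockAlpha f * 𝒢.towardBlock i f := by
      rw [Finset.mul_sum]
      exact Finset.sum_congr rfl fun f _ => mul_left_comm _ _ _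
    rw [h3]
    linear_combination 𝒢.distMat x i * h2 +
      𝒢.distMat x i * 𝒢.tauOut i * Ring.mul_inverse_cancel _ hα
  have h4 : ∀ f : Block G, ∑ i, 𝒢.distMat x i * 𝒢.towardBlock i f =
      (𝒢.distMat * 𝒢.towardMat) x j + 𝒢.multMat x j -
        (𝒢.multMat x (gate G f x) - 𝒢.distMat x (gate G f x) * Ring.inverse (𝒢.a f)) := by
    intro f
    obtain ⟨k, hk⟩ := f.nonempty
    rw [𝒢.distMat_mul_towardMat_add_const hG ha x j k, 𝒢.distMat_mul_towardMat_add hG ha x hk]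
    ring
  simp only [Matrix.mul_apply, Matrix.add_apply, Matrix.smul_apply, vecMulVec_apply, mul_one,
    smul_eq_mul]
  rw [Finset.mul_sum, Finset.sum_congr rfl fun i _ => h1 i, Finset.sum_add_distrib,
    Finset.sum_sub_distrib, Finset.sum_comm, 𝒢.sum_distMat_mul_tauOut hG hM ha]
  simp only [← Finset.mul_sum, h4, mul_sub, Finset.sum_sub_distrib, ← Finset.sum_mul]
  rw [← Matrix.mul_apply, ← 𝒢.alpha_eq hG hM ha]
  ring

theorem inv_distMat (hD : IsUnit 𝒢.distMat.det) (ha : ∀ e, IsUnit (𝒢.a e)) :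
    𝒢.distMat⁻¹ = Ring.inverse 𝒢.alpha • vecMulVec 𝒢.tauOut 𝒢.tauIn +
      𝒢.cMat * 𝒢.multMat⁻¹ := by
  refine Matrix.inv_eq_right_inv ?_
  have h : Ring.inverse 𝒢.alpha • vecMulVec 𝒢.tauOut 𝒢.tauIn + 𝒢.cMat * 𝒢.multMat⁻¹ =
      (Ring.inverse 𝒢.alpha • vecMulVec 𝒢.tauOut (fun _ => 1) + 𝒢.cMat) * 𝒢.multMat⁻¹ := by
    rw [Matrix.add_mul, Matrix.smul_mul, Matrix.vecMulVec_mul, tauIn]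
  rw [h, ← Matrix.mul_assoc, 𝒢.distMat_mul_eq_multMat hG hM hD ha, Matrix.mul_nonsing_inv _ hM]

theorem inv_distMat' (hD : IsUnit 𝒢.distMat.det) (ha : ∀ e, IsUnit (𝒢.a e)) :
    𝒢.distMat⁻¹ = Ring.inverse 𝒢.alpha • vecMulVec 𝒢.tauOut 𝒢.tauIn - 𝒢.lapMat +
      𝒢.cMat * diagonal 𝒢.tauIn := by
  refine Matrix.inv_eq_right_inv ?_
  have h : Ring.inverse 𝒢.alpha • vecMulVec 𝒢.tauOut 𝒢.tauIn - 𝒢.lapMat +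
      𝒢.cMat * diagonal 𝒢.tauIn =
      (Ring.inverse 𝒢.alpha • vecMulVec 𝒢.tauOut (fun _ => 1) + 𝒢.cMat) * diagonal 𝒢.tauIn -
        𝒢.lapMat := by
    have h1 : vecMulVec 𝒢.tauOut (fun _ => 1) * diagonal 𝒢.tauIn =
        vecMulVec 𝒢.tauOut 𝒢.tauIn := by
      ext i j
      simp [Matrix.mul_diagonal, vecMulVec_apply]
    rw [Matrix.add_mul, Matrix.smul_mul, h1]
    abel
  rw [h, Matrix.mul_sub, ← Matrix.mul_assoc, 𝒢.distMat_mul_eq_multMat hG hM hD ha,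
    𝒢.distMat_mul_lapMat hG hM ha]
  abel

end BlockDatum

/-! ### Diagonal matrices perturbed by a matrix of rank one -/

section RankOne

variable {n : Type*} [Fintype n] [DecidableEq n] {R : Type*} [CommRing R]

theorem det_diagonal_add_vecMulVec_of_isUnit (d u v : n → R) (hd : ∀ i, IsUnit (d i)) :
    (diagonal d + vecMulVec u v).det =
      ∏ i, d i + ∑ i, u i * v i * ∏ j ∈ Finset.univ.erase i, d j := by
  have h1 : diagonal d + vecMulVec u v = diagonal d *
      (1 + replicateCol Unit (fun i => Ring.inverse (d i) * u i) * replicateRow Unit v) := by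
    ext i j
    rw [Matrix.diagonal_mul]
    simp only [Matrix.add_apply, vecMulVec_apply, Matrix.mul_apply, replicateCol_apply,
      replicateRow_apply, Finset.univ_unique, Finset.sum_singleton, diagonal_apply,
      Matrix.one_apply]
    have := Ring.mul_inverse_cancel _ (hd i)
    split_ifs <;> linear_combination (-u i * v j) * this
  rw [h1, det_mul, det_diagonal, det_one_add_replicateCol_mul_replicateRow, dotProduct, mul_add,
    mul_one, Finset.mul_sum]
  congr 1
  refine Finset.sum_congr rfl fun i _ => ?_
  rw [← Finset.mul_prod_erase _ _ (Finset.mem_univ i)]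
  linear_combination (v i * u i * ∏ j ∈ Finset.univ.erase i, d j) *
    Ring.mul_inverse_cancel _ (hd i)

/-- Division by `d` is made legitimate by replacing each `d i` with the monic polynomial X + `d i`,
a non-zero-divisor and so a unit in the total fraction ring of R[X]. The identity descends to R[X]
by injectivity and is evaluated at X = 0. -/
theorem det_diagonal_add_vecMulVec (d u v : n → R) :
    (diagonal d + vecMulVec u v).det =
      ∏ i, d i + ∑ i, u i * v i * ∏ j ∈ Finset.univ.erase i, d j := by
  let K := FractionRing (Polynomial R)
  let φ : Polynomial R →+* K := algebraMap _ _
  have hφ : Function.Injective φ := IsFractionRing.injective _ _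
  let d' : n → Polynomial R := fun i => Polynomial.X + Polynomial.C (d i)
  let u' : n → Polynomial R := fun i => Polynomial.C (u i)
  let v' : n → Polynomial R := fun i => Polynomial.C (v i)
  have hd' : ∀ i, IsUnit (φ (d' i)) := fun i =>
    IsLocalization.map_units K
      (⟨d' i, (Polynomial.monic_X_add_C (d i)).mem_nonZeroDivisors⟩ :
        nonZeroDivisors (Polynomial R))
  have h1 := det_diagonal_add_vecMulVec_of_isUnit (fun i => φ (d' i)) (fun i => φ (u' i))
    (fun i => φ (v' i)) hd'
  have hmap : ∀ {S T : Type _} [CommRing S] [CommRing T] (f : S →+* T) (d u v : n → S),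
      (diagonal (fun i => f (d i)) + vecMulVec (fun i => f (u i)) (fun i => f (v i))).det =
        f (diagonal d + vecMulVec u v).det := by
    intro S T _ _ f d u v
    rw [RingHom.map_det]
    congr 1
    ext i j
    simp only [Matrix.add_apply, diagonal_apply, vecMulVec_apply, RingHom.mapMatrix_apply,
      Matrix.map_apply, map_add, map_mul]
    split_ifs <;> simp
  rw [hmap φ] at h1
  have h2 : (diagonal d' + vecMulVec u' v').det =
      ∏ i, d' i + ∑ i, u' i * v' i * ∏ j ∈ Finset.univ.erase i, d' j := by
    apply hφ
    rw [h1]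
    simp only [map_add, map_prod, map_sum, map_mul]
  have h3 := congrArg (Polynomial.evalRingHom (0 : R)) h2
  rw [← hmap] at h3
  simpa [d', u', v', Polynomial.eval_prod, Polynomial.eval_finsetSum] using h3

end RankOne

/-! ### Denominator-free adjugate of a clique matrix -/

section Adjugate

variable {V : Type*} [DecidableEq V] {R : Type*} [CommRing R] (s : Finset V) (d p q : V → R)

/-- The determinant of the matrix with diagonal entries `1` and entries `p_v q_w` off the
diagonal, where `d_v = 1 - p_v q_v`. -/
def cliqueDet : R := ∏ v ∈ s, d v + ∑ v ∈ s, p v * q v * ∏ u ∈ s.erase v, d u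

/-- The product of the `d_u` over `u ≠ v, w`. -/
def prodErase₂ (v w : V) : R := ∏ u ∈ (s.erase v).erase w, d u

/-- The diagonal entries of the adjugate. -/
def cliqueAdjDiag (v : V) : R :=
  ∏ u ∈ s.erase v, d u + ∑ u ∈ s.erase v, p u * q u * prodErase₂ s d v u

theorem prodErase₂_comm (v w : V) : prodErase₂ s d v w = prodErase₂ s d w v := by
  rw [prodErase₂, prodErase₂, Finset.erase_right_comm]

variable {s d p q}

theorem mul_prodErase₂ {v w : V} (hw : w ∈ s) (hvw : w ≠ v) :
    d w * prodErase₂ s d v w = ∏ u ∈ s.erase v, d u :=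
  Finset.mul_prod_erase _ _ (Finset.mem_erase.2 ⟨hvw, hw⟩)

variable (hd : ∀ v, d v = 1 - p v * q v)

include hd

/-- Since d_v + p_v q_v = 1, the term of `v` in the sum merges with the full product into the
product without d_v. -/
theorem cliqueDet_eq {v : V} (hv : v ∈ s) :
    cliqueDet s d p q = ∏ u ∈ s.erase v, d u +
      ∑ w ∈ s.erase v, p w * q w * (d v * prodErase₂ s d v w) := by
  rw [cliqueDet, ← Finset.mul_prod_erase _ _ hv, ← Finset.add_sum_erase _ _ hv]
  have h : ∀ w ∈ s.erase v, p w * q w * (d v * prodErase₂ s d v w) =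
      p w * q w * ∏ u ∈ s.erase w, d u := by
    intro w hw
    rw [prodErase₂_comm, mul_prodErase₂ hv (Finset.ne_of_mem_erase hw).symm]
  rw [Finset.sum_congr rfl h]
  linear_combination (∏ u ∈ s.erase v, d u) * hd v

theorem clique_adj_diag {v : V} (hv : v ∈ s) :
    cliqueAdjDiag s d p q v +
      ∑ z ∈ s.erase v, p v * q z * -(p z * q v * prodErase₂ s d z v) =
      cliqueDet s d p q := by
  rw [cliqueDet_eq hd hv, cliqueAdjDiag, add_assoc, ← Finset.sum_add_distrib]
  congr 1
  refine Finset.sum_congr rfl fun z _ => ?_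
  rw [hd v, prodErase₂_comm s d z v]
  ring

/-- The sum cancels against the part of `cliqueAdjDiag` with index other than `v`; the remaining
factor is -1 + d_v + p_v q_v = 0. -/
theorem clique_adj_offDiag {v w : V} (hv : v ∈ s) (hvw : v ≠ w) :
    -(p v * q w * prodErase₂ s d v w) + p v * q w * cliqueAdjDiag s d p q w +
      ∑ z ∈ (s.erase v).erase w, p v * q z * -(p z * q w * prodErase₂ s d z w) = 0 := by
  have h1 := mul_prodErase₂ (s := s) (d := d) hv hvw
  have h2 : ∑ z ∈ (s.erase v).erase w, p v * q z * -(p z * q w * prodErase₂ s d z w) =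
      -(p v * q w) * ∑ z ∈ (s.erase w).erase v, p z * q z * prodErase₂ s d w z := by
    rw [Finset.mul_sum, Finset.erase_right_comm]
    refine Finset.sum_congr rfl fun z _ => ?_
    rw [prodErase₂_comm s d z w]
    ring
  rw [h2, cliqueAdjDiag, ← Finset.add_sum_erase _ _ (Finset.mem_erase.2 ⟨hvw, hv⟩), ← h1,
    prodErase₂_comm s d v w, hd v]
  ring

/-- The product without d_v cancels. The rest agrees termwise, as p_w q_w (d_v - 1) + p_w q_v = p_w
q_v (1 - p_v q_w). -/
theorem cliqueDet_sub_colSum {v : V} (hv : v ∈ s) :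
    cliqueDet s d p q - (cliqueAdjDiag s d p q v +
      ∑ w ∈ s.erase v, -(p w * q v * prodErase₂ s d w v)) =
      ∑ w ∈ s.erase v, p w * q v * (1 - p v * q w) * prodErase₂ s d v w := by
  rw [cliqueDet_eq hd hv, cliqueAdjDiag, add_assoc, add_sub_add_left_eq_sub,
    ← Finset.sum_add_distrib, ← Finset.sum_sub_distrib]
  refine Finset.sum_congr rfl fun w _ => ?_
  rw [hd v, prodErase₂_comm s d w v]
  ring

omit hd in
theorem cliqueDet_swap : cliqueDet s d q p = cliqueDet s d p q := by
  simp only [cliqueDet, mul_comm]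

omit hd in
theorem cliqueAdjDiag_swap (v : V) : cliqueAdjDiag s d q p v = cliqueAdjDiag s d p q v := by
  simp only [cliqueAdjDiag, mul_comm]

theorem cliqueDet_sub_rowSum {v : V} (hv : v ∈ s) :
    cliqueDet s d p q - (cliqueAdjDiag s d p q v +
      ∑ w ∈ s.erase v, -(p v * q w * prodErase₂ s d v w)) =
      ∑ w ∈ s.erase v, q w * p v * (1 - q v * p w) * prodErase₂ s d v w := by
  have h := cliqueDet_sub_colSum (p := q) (q := p) (s := s) (d := d)
    (fun v => by rw [hd v, mul_comm]) hv
  rw [← h, cliqueDet_swap, cliqueAdjDiag_swap]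
  congr 2
  refine Finset.sum_congr rfl fun w _ => ?_
  rw [prodErase₂_comm s d v w, mul_comm (p v)]

end Adjugate

/-! ### Total sum of the adjugate over ordered pairs -/

section OrderedSum

variable {V : Type*} [LinearOrder V] {R : Type*} [CommRing R]

theorem sum_sum_erase_eq (s : Finset V) (F : V → V → R) :
    ∑ v ∈ s, ∑ w ∈ s.erase v, F v w = ∑ v ∈ s, ∑ w ∈ s with v < w, (F v w + F w v) := by
  have h : ∀ v ∈ s, ∑ w ∈ s.erase v, F v w =
      ∑ w ∈ s, (if v < w then F v w else 0) + ∑ w ∈ s, if w < v then F v w else 0 := by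
    intro v hv
    rw [← Finset.sum_add_distrib, ← Finset.add_sum_erase s _ hv]
    simp only [lt_irrefl, if_false, add_zero, zero_add]
    refine Finset.sum_congr rfl fun w hw => ?_
    rcases lt_or_gt_of_ne (Finset.ne_of_mem_erase hw) with h | h <;> simp [h, h.not_gt]
  rw [Finset.sum_congr rfl h, Finset.sum_add_distrib,
    Finset.sum_comm (f := fun v w => if w < v then F v w else 0), ← Finset.sum_add_distrib]
  refine Finset.sum_congr rfl fun v _ => ?_
  rw [← Finset.sum_add_distrib, Finset.sum_filter]
  refine Finset.sum_congr rfl fun w _ => ?_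
  split_ifs <;> simp

/-- The products without d_v cancel between the determinant and the column sums, leaving 1 - |s|
full products. A pair v < w contributes p_w (q_w - q_v) + p_v (q_v - q_w), which factors. -/
theorem cliqueDet_sub_sum {s : Finset V} {d p q : V → R}
    (hd : ∀ v, d v = 1 - p v * q v) :
    cliqueDet s d p q - ∑ v ∈ s, (cliqueAdjDiag s d p q v +
      ∑ w ∈ s.erase v, -(p w * q v * prodErase₂ s d w v)) =
      -(((s.card : R) - 1) * ∏ u ∈ s, d u +
        ∑ v ∈ s, ∑ w ∈ s with v < w, (p v - p w) * (q v - q w) * prodErase₂ s d v w) := by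
  have h1 : ∀ v ∈ s, cliqueAdjDiag s d p q v +
      ∑ w ∈ s.erase v, -(p w * q v * prodErase₂ s d w v) = ∏ u ∈ s.erase v, d u +
      ∑ w ∈ s.erase v, p w * (q w - q v) * prodErase₂ s d v w := by
    intro v _
    rw [cliqueAdjDiag, add_assoc, ← Finset.sum_add_distrib]
    congr 1
    refine Finset.sum_congr rfl fun w _ => ?_
    rw [prodErase₂_comm s d w v]
    ring
  have h2 : ∀ v ∈ s, p v * q v * ∏ u ∈ s.erase v, d u =
      ∏ u ∈ s.erase v, d u - ∏ u ∈ s, d u := by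
    intro v hv
    rw [← Finset.mul_prod_erase _ _ hv, hd v]
    ring
  rw [Finset.sum_congr rfl h1, Finset.sum_add_distrib, sum_sum_erase_eq, cliqueDet,
    Finset.sum_congr rfl h2, Finset.sum_sub_distrib, Finset.sum_const, nsmul_eq_mul]
  have h3 : ∑ v ∈ s, ∑ w ∈ s with v < w, (p w * (q w - q v) * prodErase₂ s d v w +
      p v * (q v - q w) * prodErase₂ s d w v) =
      ∑ v ∈ s, ∑ w ∈ s with v < w, (p v - p w) * (q v - q w) * prodErase₂ s d v w := by
    refine Finset.sum_congr rfl fun v _ => Finset.sum_congr rfl fun w _ => ?_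
    rw [prodErase₂_comm s d w v]
    ring
  rw [h3]
  ring

end OrderedSum

/-! ### The clique model -/

section CliqueModel

variable {V : Type*} [Fintype V] [DecidableEq V] {G : SimpleGraph V} {R : Type*} [CommRing R]
  {a : Block G → R} {m m' : Block G → V → R}

theorem clearedDen_eq_cliqueDet (e : Block G) :
    clearedDen m m' e = cliqueDet e.verts (delta m m' e) (m e) (m' e) := rfl

theorem frac₃_eq (e : Block G) (v w : V) :
    frac₃ m m' e v w = Ring.inverse (clearedDen m m' e) *
      prodErase₂ e.verts (delta m m' e) v w := rfl

theorem delta_eq (e : Block G) (v : V) : delta m m' e v = 1 - m e v * m' e v := rfl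

theorem det_cliqueDatum_Dstar (e : Block G) :
    ((cliqueDatum a m m').Dstar e).det = clearedDen m m' e := by
  have h : (cliqueDatum a m m').Dstar e = diagonal (fun v : e.verts => delta m m' e v) +
      vecMulVec (fun v : e.verts => m e v) (fun v : e.verts => m' e v) := by
    ext v w
    simp only [cliqueDatum, of_apply, Matrix.add_apply, diagonal_apply, vecMulVec_apply, delta]
    split_ifs with hvw
    · rw [hvw]; ring
    · ring
  have hprod : ∀ v : e.verts, ∏ u ∈ Finset.univ.erase v, delta m m' e (u : V) =
      ∏ u ∈ e.verts.erase v, delta m m' e u := by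
    intro v
    refine Finset.prod_bij (fun u _ => (u : V)) ?_ ?_ ?_ ?_
    · intro u hu
      exact Finset.mem_erase.2 ⟨fun h => Finset.ne_of_mem_erase hu (Subtype.ext h), u.2⟩
    · intro u _ w _ huw
      exact Subtype.ext huw
    · intro u hu
      exact ⟨⟨u, Finset.mem_of_mem_erase hu⟩, Finset.mem_erase.2
        ⟨fun h => Finset.ne_of_mem_erase hu (congrArg Subtype.val h), Finset.mem_univ _⟩, rfl⟩
    · intro _ _
      rfl
  rw [h, det_diagonal_add_vecMulVec, clearedDen, ← Finset.prod_coe_sort e.verts,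
    ← Finset.sum_coe_sort e.verts]
  simp only [hprod]

theorem cliqueDatum_multDist {e : Block G} {x y : V} (hx : x ∈ e.verts) (hy : y ∈ e.verts) :
    (cliqueDatum a m m').multDist x y = if x = y then 1 else m e x * m' e y := by
  rw [BlockDatum.multDist_eq_Dstar _ hx hy]
  simp [cliqueDatum]

variable (hG : G.Connected) (hM : IsUnit (cliqueDatum a m m').multMat.det)

include hG hM

theorem isUnit_clearedDen (e : Block G) : IsUnit (clearedDen m m' e) := by
  rw [← det_cliqueDatum_Dstar (a := a)]
  exact BlockDatum.isUnit_det_Dstar _ hG hM e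

/-- The adjugate of a block of the clique model. -/
theorem clearedDen_mul_blockInv {e : Block G} {v w : V} (hv : v ∈ e.verts) (hw : w ∈ e.verts) :
    clearedDen m m' e * (cliqueDatum a m m').blockInv e v w =
      if v = w then cliqueAdjDiag e.verts (delta m m' e) (m e) (m' e) v
      else -(m e v * m' e w * prodErase₂ e.verts (delta m m' e) v w) := by
  set 𝒢 := cliqueDatum a m m'
  set A : V → V → R := fun v w =>
    if v = w then cliqueAdjDiag e.verts (delta m m' e) (m e) (m' e) v
      else -(m e v * m' e w * prodErase₂ e.verts (delta m m' e) v w) with hA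
  have hd := delta_eq (m := m) (m' := m') e
  have h1 : ∀ x ∈ e.verts, ∑ z ∈ e.verts, 𝒢.multDist x z * A z w =
      if x = w then clearedDen m m' e else 0 := by
    intro x hx
    have h2 : ∀ z ∈ e.verts.erase x, 𝒢.multDist x z * A z w = m e x * m' e z * A z w := by
      intro z hz
      rw [cliqueDatum_multDist hx (Finset.mem_of_mem_erase hz),
        if_neg (Finset.ne_of_mem_erase hz).symm]
    rw [← Finset.add_sum_erase _ _ hx, Finset.sum_congr rfl h2, 𝒢.multDist_self, one_mul]
    split_ifs with hxw
    · subst hxw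
      rw [clearedDen_eq_cliqueDet, ← clique_adj_diag hd hx]
      simp only [hA, if_true]
      congr 1
      refine Finset.sum_congr rfl fun z hz => ?_
      rw [if_neg (Finset.ne_of_mem_erase hz)]
    · rw [← clique_adj_offDiag hd hx hxw, ← Finset.add_sum_erase _ _
        (Finset.mem_erase.2 ⟨Ne.symm hxw, hw⟩)]
      simp only [hA, if_true, if_neg hxw]
      rw [add_assoc]
      congr 2
      refine Finset.sum_congr rfl fun z hz => ?_
      rw [if_neg (Finset.ne_of_mem_erase hz)]
  -- By `h1`, D*_e times `A` is N_e times the identity; multiplying on the left by the known inverse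
  -- identifies `A` with N_e times that inverse.
  have h3 : ∑ x ∈ e.verts, 𝒢.blockInv e v x * ∑ z ∈ e.verts, 𝒢.multDist x z * A z w = A v w := by
    simp only [Finset.mul_sum, ← mul_assoc]
    rw [Finset.sum_comm]
    simp only [← Finset.sum_mul]
    rw [Finset.sum_congr rfl fun z hz => by rw [𝒢.sum_blockInv_mul_multDist hG hM v hz]]
    simp [hv]
  rw [Finset.sum_congr rfl fun x hx => by rw [h1 x hx]] at h3
  simp only [mul_ite, mul_zero, Finset.sum_ite_eq', if_pos hw] at h3
  rw [mul_comm, h3]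

theorem blockInv_eq_of_ne {e : Block G} {v w : V} (hv : v ∈ e.verts) (hw : w ∈ e.verts)
    (hvw : v ≠ w) :
    (cliqueDatum a m m').blockInv e v w = -(m e v * m' e w * frac₃ m m' e v w) := by
  have h := clearedDen_mul_blockInv hG hM hv hw
  rw [if_neg hvw] at h
  rw [frac₃_eq]
  linear_combination Ring.inverse (clearedDen m m' e) * h -
    (cliqueDatum a m m').blockInv e v w *
      Ring.inverse_mul_cancel _ (isUnit_clearedDen hG hM e)

theorem clearedDen_mul_blockIn {e : Block G} {v : V} (hv : v ∈ e.verts) :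
    clearedDen m m' e * (cliqueDatum a m m').blockIn e v =
      cliqueAdjDiag e.verts (delta m m' e) (m e) (m' e) v +
      ∑ w ∈ e.verts.erase v, -(m e w * m' e v * prodErase₂ e.verts (delta m m' e) w v) := by
  rw [BlockDatum.blockIn, Finset.mul_sum, ← Finset.add_sum_erase _ _ hv,
    clearedDen_mul_blockInv hG hM hv hv, if_pos rfl]
  congr 1
  refine Finset.sum_congr rfl fun w hw => ?_
  rw [clearedDen_mul_blockInv hG hM (Finset.mem_of_mem_erase hw) hv,
    if_neg (Finset.ne_of_mem_erase hw)]

theorem clearedDen_mul_blockOut {e : Block G} {v : V} (hv : v ∈ e.verts) :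
    clearedDen m m' e * (cliqueDatum a m m').blockOut e v =
      cliqueAdjDiag e.verts (delta m m' e) (m e) (m' e) v +
      ∑ w ∈ e.verts.erase v, -(m e v * m' e w * prodErase₂ e.verts (delta m m' e) v w) := by
  rw [BlockDatum.blockOut, Finset.mul_sum, ← Finset.add_sum_erase _ _ hv,
    clearedDen_mul_blockInv hG hM hv hv, if_pos rfl]
  congr 1
  refine Finset.sum_congr rfl fun w hw => ?_
  rw [clearedDen_mul_blockInv hG hM hv (Finset.mem_of_mem_erase hw),
    if_neg (Finset.ne_of_mem_erase hw).symm]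

theorem one_sub_blockIn {e : Block G} {v : V} (hv : v ∈ e.verts) :
    1 - (cliqueDatum a m m').blockIn e v = ∑ w ∈ e.verts.erase v,
      m e w * m' e v * (1 - m e v * m' e w) * frac₃ m m' e v w := by
  have h := cliqueDet_sub_colSum (delta_eq (m := m) (m' := m') e) hv
  rw [← clearedDen_mul_blockIn hG hM hv, ← clearedDen_eq_cliqueDet] at h
  simp only [frac₃_eq, mul_left_comm _ (Ring.inverse _) _, ← Finset.mul_sum]
  rw [← h]
  linear_combination ((cliqueDatum a m m').blockIn e v - 1) *
      Ring.inverse_mul_cancel _ (isUnit_clearedDen hG hM e)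

theorem one_sub_blockOut {e : Block G} {v : V} (hv : v ∈ e.verts) :
    1 - (cliqueDatum a m m').blockOut e v = ∑ w ∈ e.verts.erase v,
      m' e w * m e v * (1 - m' e v * m e w) * frac₃ m m' e v w := by
  have h := cliqueDet_sub_rowSum (delta_eq (m := m) (m' := m') e) hv
  rw [← clearedDen_mul_blockOut hG hM hv, ← clearedDen_eq_cliqueDet] at h
  simp only [frac₃_eq, mul_left_comm _ (Ring.inverse _) _, ← Finset.mul_sum]
  rw [← h]
  linear_combination ((cliqueDatum a m m').blockOut e v - 1) *
      Ring.inverse_mul_cancel _ (isUnit_clearedDen hG hM e)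

theorem tauIn_cliqueDatum (v : V) :
    (cliqueDatum a m m').tauIn v = 1 - ∑ e : Block G with v ∈ e.verts, ∑ w ∈ e.verts.erase v,
      m e w * m' e v * (1 - m e v * m' e w) * frac₃ m m' e v w := by
  rw [BlockDatum.tauIn_eq _ hG hM, Finset.sum_filter, sub_eq_add_neg, ← Finset.sum_neg_distrib]
  congr 1
  refine Finset.sum_congr rfl fun e _ => ?_
  split_ifs with hv
  · rw [← one_sub_blockIn hG hM hv, neg_sub]
  · rw [BlockDatum.blockIn_eq_zero _ hv, sub_zero, neg_zero]

theorem tauOut_cliqueDatum (v : V) :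
    (cliqueDatum a m m').tauOut v = 1 - ∑ e : Block G with v ∈ e.verts, ∑ w ∈ e.verts.erase v,
      m' e w * m e v * (1 - m' e v * m e w) * frac₃ m m' e v w := by
  rw [BlockDatum.tauOut_eq _ hG hM, Finset.sum_filter, sub_eq_add_neg, ← Finset.sum_neg_distrib]
  congr 1
  refine Finset.sum_congr rfl fun e _ => ?_
  split_ifs with hv
  · rw [← one_sub_blockOut hG hM hv, neg_sub]
  · rw [BlockDatum.blockOut_eq_zero _ hv, sub_zero, neg_zero]

theorem lapMat_cliqueDatum_of_mem {e : Block G} {v w : V} (hv : v ∈ e.verts)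
    (hw : w ∈ e.verts) (hvw : v ≠ w) :
    (cliqueDatum a m m').lapMat v w =
      Ring.inverse (a e) * (m e v * m' e w * frac₃ m m' e v w) := by
  rw [BlockDatum.lapMat_eq _ hG hM, Finset.sum_eq_single e]
  · rw [blockInv_eq_of_ne hG hM hv hw hvw, if_neg hvw]
    simp [cliqueDatum]
  · intro f _ hfe
    have h : (cliqueDatum a m m').blockInv f v w = 0 :=
      dif_neg fun h' => hfe (Block.eq_of_two_mem hvw h'.1 h'.2 hv hw)
    rw [h, if_neg hvw]
    simp
  · simp

theorem lapMat_cliqueDatum_of_not_mem {v w : V} (hvw : v ≠ w)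
    (h : ∀ e : Block G, ¬ (v ∈ e.verts ∧ w ∈ e.verts)) :
    (cliqueDatum a m m').lapMat v w = 0 := by
  rw [BlockDatum.lapMat_eq _ hG hM]
  refine Finset.sum_eq_zero fun e _ => ?_
  have h' : (cliqueDatum a m m').blockInv e v w = 0 := dif_neg (h e)
  rw [h', if_neg hvw]
  simp

theorem lapMat_cliqueDatum_self (w : V) :
    (cliqueDatum a m m').lapMat w w = ∑ e : Block G with w ∈ e.verts,
      -(Ring.inverse (a e) * ∑ u ∈ e.verts.erase w, m e u * m' e w * frac₃ m m' e u w) := by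
  rw [BlockDatum.lapMat_eq _ hG hM, Finset.sum_filter]
  refine Finset.sum_congr rfl fun e _ => ?_
  rw [if_pos rfl]
  split_ifs with hw
  · rw [BlockDatum.blockIn, ← Finset.add_sum_erase _ _ hw, sub_add_cancel_left,
      ← Finset.sum_neg_distrib, Finset.sum_congr rfl fun u hu => by
      rw [blockInv_eq_of_ne hG hM (Finset.mem_of_mem_erase hu) hw (Finset.ne_of_mem_erase hu),
        neg_neg]]
    rfl
  · rw [BlockDatum.blockIn_eq_zero _ hw, BlockDatum.blockInv_eq_zero_left _ hw]
    simp

/-! ### Literal meaning of the cleared fractions -/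

omit hG hM

theorem clearedDen_eq_mul {e : Block G} (h : ∀ v ∈ e.verts, IsUnit (delta m m' e v)) :
    clearedDen m m' e = (1 + dSum m m' e) * ∏ v ∈ e.verts, delta m m' e v := by
  rw [clearedDen, dSum, add_mul, one_mul, Finset.sum_mul]
  congr 1
  refine Finset.sum_congr rfl fun v hv => ?_
  rw [← Finset.mul_prod_erase _ _ hv]
  linear_combination (-m e v * m' e v * ∏ u ∈ e.verts.erase v, delta m m' e u) *
    Ring.mul_inverse_cancel _ (h v hv)

theorem eq_ringInverse_of_mul_eq_one {x y : R} (h : x * y = 1) : y = Ring.inverse x := by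
  have hx : IsUnit x := IsUnit.of_mul_eq_one y h
  linear_combination Ring.inverse x * h - y * Ring.inverse_mul_cancel _ hx

theorem isUnit_one_add_dSum {e : Block G} (hN : IsUnit (clearedDen m m' e))
    (h : ∀ v ∈ e.verts, IsUnit (delta m m' e v)) : IsUnit (1 + dSum m m' e) :=
  isUnit_of_mul_isUnit_left (clearedDen_eq_mul h ▸ hN)

theorem frac₁_eq {e : Block G} (hN : IsUnit (clearedDen m m' e))
    (h : ∀ v ∈ e.verts, IsUnit (delta m m' e v)) :
    frac₁ m m' e = Ring.inverse (1 + dSum m m' e) := by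
  apply eq_ringInverse_of_mul_eq_one
  have h1 := Ring.mul_inverse_cancel _ hN
  have h2 := clearedDen_eq_mul h
  rw [frac₁]
  linear_combination h1 - Ring.inverse (clearedDen m m' e) * h2

theorem frac₃_eq_inverse {e : Block G} (hN : IsUnit (clearedDen m m' e))
    (h : ∀ v ∈ e.verts, IsUnit (delta m m' e v)) {v w : V} (hv : v ∈ e.verts)
    (hw : w ∈ e.verts) (hvw : v ≠ w) :
    frac₃ m m' e v w =
      Ring.inverse ((1 + dSum m m' e) * (delta m m' e v * delta m m' e w)) := by
  apply eq_ringInverse_of_mul_eq_one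
  have h1 := Ring.mul_inverse_cancel _ hN
  have h2 := clearedDen_eq_mul h
  rw [← Finset.mul_prod_erase _ _ hv, ← mul_prodErase₂ hw (Ne.symm hvw)] at h2
  rw [frac₃_eq]
  linear_combination h1 - Ring.inverse (clearedDen m m' e) * h2

end CliqueModel

theorem blockAlpha_cliqueDatum {V : Type*} [Fintype V] [LinearOrder V] {G : SimpleGraph V}
    {R : Type*} [CommRing R] {a : Block G → R} {m m' : Block G → V → R} (hG : G.Connected)
    (hM : IsUnit (cliqueDatum a m m').multMat.det) (e : Block G) :
    (cliqueDatum a m m').blockAlpha e = cliqueAlpha a m m' e := by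
  have h := cliqueDet_sub_sum (s := e.verts) (delta_eq (m := m) (m' := m') e)
  rw [← Finset.sum_congr rfl fun v hv => clearedDen_mul_blockIn hG hM hv, ← Finset.mul_sum,
    ← clearedDen_eq_cliqueDet] at h
  have h1 := Ring.inverse_mul_cancel _ (isUnit_clearedDen hG hM e)
  rw [BlockDatum.blockAlpha, cliqueAlpha, frac₁]
  simp only [frac₃_eq, mul_left_comm _ (Ring.inverse _) _, ← Finset.mul_sum]
  change a e * _ = _
  linear_combination a e * Ring.inverse (clearedDen m m' e) * h -
    a e * (1 - ∑ x ∈ e.verts, (cliqueDatum a m m').blockIn e x) * h1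

end AddMulGraph


theorem mainTheorem10 {V : Type*} [Fintype V] [LinearOrder V] {R : Type*} [CommRing R]
    (G : SimpleGraph V) (hG : AddMulGraph.IsHypertree G)
    (a : AddMulGraph.Block G → R) (m m' : AddMulGraph.Block G → V → R)
    (𝒢 : AddMulGraph.BlockDatum G R) (h𝒢 : 𝒢 = AddMulGraph.cliqueDatum a m m')
    (ha : ∀ e, IsUnit (a e)) (hM : IsUnit 𝒢.multMat.det) :
    -- the fractions in the closed forms below are well defined, and have their literal meaning
    -- as soon as the elements `1 - m_{e,v} m'_{e,v}` are invertible
    (∀ e : AddMulGraph.Block G, IsUnit (AddMulGraph.clearedDen m m' e) ∧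
      ((∀ v ∈ e.verts, IsUnit (AddMulGraph.delta m m' e v)) →
        IsUnit (1 + AddMulGraph.dSum m m' e) ∧
        AddMulGraph.frac₁ m m' e = Ring.inverse (1 + AddMulGraph.dSum m m' e) ∧
        ∀ v ∈ e.verts, ∀ w ∈ e.verts, v ≠ w →
          AddMulGraph.frac₃ m m' e v w =
            Ring.inverse ((1 + AddMulGraph.dSum m m' e) *
              (AddMulGraph.delta m m' e v * AddMulGraph.delta m m' e w)))) ∧
    -- the invariants `κ` are well defined and invertible
    ((∀ v₀ : V, AddMulGraph.kappaAt 𝒢.distMat 𝒢.multMat v₀ = 𝒢.kap) ∧ IsUnit 𝒢.kap) ∧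
    (∀ e : AddMulGraph.Block G,
      (∀ v₀ : e.verts, AddMulGraph.kappaAt (𝒢.blockMat e) (𝒢.Dstar e) v₀ = 𝒢.blockKap e) ∧
        IsUnit (𝒢.blockKap e)) ∧
    -- `α`, `τ_in`, `τ_out`
    𝒢.alpha = ∑ e : AddMulGraph.Block G, AddMulGraph.cliqueAlpha a m m' e ∧
    (∀ v : V, 𝒢.tauIn v = 1 - ∑ e : AddMulGraph.Block G with v ∈ e.verts,
      ∑ w ∈ e.verts.erase v,
        m e w * m' e v * (1 - m e v * m' e w) * AddMulGraph.frac₃ m m' e v w) ∧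
    (∀ v : V, 𝒢.tauOut v = 1 - ∑ e : AddMulGraph.Block G with v ∈ e.verts,
      ∑ w ∈ e.verts.erase v,
        m' e w * m e v * (1 - m' e v * m e w) * AddMulGraph.frac₃ m m' e v w) ∧
    -- the Laplacian
    (∀ v w : V, v ≠ w → ¬ G.Adj v w → 𝒢.lapMat v w = 0) ∧
    (∀ (e : AddMulGraph.Block G) (v w : V), v ∈ e.verts → w ∈ e.verts → G.Adj v w →
      𝒢.lapMat v w =
        Ring.inverse (a e) * (m e v * m' e w * AddMulGraph.frac₃ m m' e v w)) ∧
    (∀ w : V, 𝒢.lapMat w w = ∑ e : AddMulGraph.Block G with w ∈ e.verts,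
      -(Ring.inverse (a e) * ∑ u ∈ e.verts.erase w,
        m e u * m' e w * AddMulGraph.frac₃ m m' e u w)) ∧
    -- the inverse, in both forms, and the `β_i` entering in `C`
    (IsUnit 𝒢.distMat.det →
      IsUnit 𝒢.alpha ∧
      (∀ i : V, 𝒢.beta i = Ring.inverse 𝒢.alpha *
        ∑ e : AddMulGraph.Block G with i ∈ e.verts, Ring.inverse (a e) *
          ∑ f : AddMulGraph.Block G with (f.verts : Set V) ⊆ AddMulGraph.branch G i e,
            AddMulGraph.cliqueAlpha a m m' f) ∧
      𝒢.distMat⁻¹ =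
        Ring.inverse 𝒢.alpha • Matrix.vecMulVec 𝒢.tauOut 𝒢.tauIn + 𝒢.cMat * 𝒢.multMat⁻¹ ∧
      𝒢.distMat⁻¹ =
        Ring.inverse 𝒢.alpha • Matrix.vecMulVec 𝒢.tauOut 𝒢.tauIn - 𝒢.lapMat +
          𝒢.cMat * Matrix.diagonal 𝒢.tauIn) := by
  subst h𝒢
  obtain ⟨hc, hclique⟩ := hG
  have hN := AddMulGraph.isUnit_clearedDen hc hM
  refine ⟨fun e => ⟨hN e, fun h => ⟨AddMulGraph.isUnit_one_add_dSum (hN e) h,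
      AddMulGraph.frac₁_eq (hN e) h,
      fun v hv w hw => AddMulGraph.frac₃_eq_inverse (hN e) h hv hw⟩⟩,
    ⟨AddMulGraph.BlockDatum.kappaAt_distMat _ hc hM,
      AddMulGraph.BlockDatum.isUnit_kap _ hc hM ha⟩,
    fun e => ⟨AddMulGraph.BlockDatum.kappaAt_blockMat _ hc hM e,
      AddMulGraph.BlockDatum.isUnit_blockKap _ hc hM ha e⟩,
    ?_, AddMulGraph.tauIn_cliqueDatum hc hM, AddMulGraph.tauOut_cliqueDatum hc hM,
    ?_, ?_, AddMulGraph.lapMat_cliqueDatum_self hc hM, fun hD => ⟨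
      AddMulGraph.BlockDatum.isUnit_alpha _ hc hM hD ha, fun i => ?_,
      AddMulGraph.BlockDatum.inv_distMat _ hc hM hD ha,
      AddMulGraph.BlockDatum.inv_distMat' _ hc hM hD ha⟩⟩
  · rw [AddMulGraph.BlockDatum.alpha_eq _ hc hM ha]
    exact Finset.sum_congr rfl fun e _ => AddMulGraph.blockAlpha_cliqueDatum hc hM e
  · intro v w hvw hadj
    -- The only use of the clique hypothesis: distinct vertices in a common block are adjacent.
    refine AddMulGraph.lapMat_cliqueDatum_of_not_mem hc hM hvw fun e he => hadj ?_
    exact hclique e he.1 he.2 hvw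
  · intro e v w hv hw hadj
    exact AddMulGraph.lapMat_cliqueDatum_of_mem hc hM hv hw hadj.ne
  · rw [AddMulGraph.BlockDatum.beta_eq _ hc hM hD ha]
    simp only [AddMulGraph.blockAlpha_cliqueDatum hc hM]
    rfl
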